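/- Let $\Bbbk$ be a field of characteristic $0$, let $A$ be a commutative $\Bbbk$-algebra, and let $(A,\mathfrak g,\omega)$ be a Lie–Rinehart algebra over $A$ (a $\Bbbk$-Lie algebra $\mathfrak g$ with an $A$-module structure and an $A$-linear morphism of Lie algebras $\omega\colon\mathfrak g\to\mathrm{Der}_{\Bbbk}(A)$ such that $[X,aY]=a[X,Y]+\omega(X)(a)Y$) which is projective as an $A$-module. Let $\mathcal U_A(\mathfrak g)$ be its universal enveloping algebra, that is, the $\Bbbk$-algebra which is universal among those with a morphism of algebras $\iota_A$ from $A$ and a morphism of Lie algebras $\iota_{\mathfrak g}$ from $\mathfrak g$ satisfying $\iota_{\mathfrak g}(aX)=\iota_A(a)\iota_{\mathfrak g}(X)$ and $\iota_{\mathfrak g}(X)\iota_A(a)-\iota_A(a)\iota_{\mathfrak g}(X)=\iota_A(\omega(X)(a))$. Regard $\mathcal U_A(\mathfrak g)$ as an $A$-module by left multiplication, and as an $A$-coring (for the $A$-bimodule structure with both actions given by this left action, so that an $A$-coring here is the same as an $A$-coalgebra) with the left $A$-linear comultiplication and counit determined by $$\Delta(1)=1\otimes_A 1,\quad \Delta(Xu)=Xu_{(1)}\otimes_A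 u_{(2)}+u_{(1)}\otimes_A Xu_{(2)},\qquad \varepsilon(1)=1,\quad \varepsilon(Xu)=\omega(X)(\varepsilon(u))$$ for $X\in\mathfrak g$ and $u\in\mathcal U_A(\mathfrak g)$. Regard the symmetric algebra $\mathcal S_A(\mathfrak g)$ as an $A$-coring with its usual $A$-bialgebra structure, in which the elements of $\mathfrak g$ are primitive. Let $\{\chi_i,\varphi_i\mid i\in I\}$ be a projective basis of $\mathfrak g$, that is, $\chi_i\in\mathfrak g$ and $\varphi_i\in\mathrm{Hom}_A(\mathfrak g,A)$ are such that for every $X\in\mathfrak g$ one has $\varphi_i(X)=0$ for all but finitely many $i$, and $X=\sum_i\varphi_i(X)\chi_i$. Let $\mathrm S\colon\mathcal S_A(\mathfrak g)\to\mathcal U_A(\mathfrak g)$ be the associated symmetrisation map, that is, the $A$-linear map with $$\mathrm S(X_1\cdots X_n)=\frac1{n!}\sum_{j_1,\dots,j_n\in I}\ \sum_{\sigma\in\mathfrak S_n}\varphi_{j_1}(X_1)\cdots\varphi_{j_n}(X_n)\,\chi_{j_{\sigma(1)}}\cdots\chi_{j_{\sigma(n)}}$$ for all $n\ge 0$ and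 $X_1,\dots,X_n\in\mathfrak g$ (for $n=0$ this reads $\mathrm S(1)=1$). Then $\mathrm S$ is an isomorphism of $A$-corings: it is $A$-linear and bijective, $\Delta_{\mathcal U}\circ \mathrm S=(\mathrm S\otimes_A \mathrm S)\circ\Delta_{\mathcal S}$ and $\varepsilon_{\mathcal U}\circ \mathrm S=\varepsilon_{\mathcal S}$. -/

import Mathlib

open scoped TensorProduct

/-! ### The universal enveloping algebra of a Lie-Rinehart algebra

A Lie-Rinehart algebra `(A, g, ω)` over `k` is Mathlib's `LieRinehartAlgebra k A g`; the value
`ω(X)(a)` of the anchor is written `⁅X, a⁆`. -/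

namespace LRUniversalEnveloping

/-- The relations of `U_A(g)`, imposed on the free `k`-algebra on the disjoint union of `A` and `g`:
`A → U` is a morphism of `k`-algebras, `g → U` is a morphism of `k`-Lie algebras,
`ι(a • X) = ι(a) ι(X)` and `ι(X) ι(a) - ι(a) ι(X) = ι(ω(X)(a))`. -/
inductive Rel (k A g : Type*) [CommRing k] [CommRing A] [Algebra k A] [LieRing g] [LieAlgebra k g]
    [Module A g] [LieRingModule g A] : FreeAlgebra k (A ⊕ g) → FreeAlgebra k (A ⊕ g) → Prop
  | scalar (r : k) : Rel k A g (FreeAlgebra.ι k (.inl (algebraMap k A r)))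
      (algebraMap k (FreeAlgebra k (A ⊕ g)) r)
  | base_add (a b : A) : Rel k A g (FreeAlgebra.ι k (.inl (a + b)))
      (FreeAlgebra.ι k (.inl a) + FreeAlgebra.ι k (.inl b))
  | base_mul (a b : A) : Rel k A g (FreeAlgebra.ι k (.inl (a * b)))
      (FreeAlgebra.ι k (.inl a) * FreeAlgebra.ι k (.inl b))
  | lie_add (X Y : g) : Rel k A g (FreeAlgebra.ι k (.inr (X + Y)))
      (FreeAlgebra.ι k (.inr X) + FreeAlgebra.ι k (.inr Y))
  | lie_smul (r : k) (X : g) : Rel k A g (FreeAlgebra.ι k (.inr (r • X)))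
      (r • FreeAlgebra.ι k (.inr X))
  | lie_bracket (X Y : g) : Rel k A g (FreeAlgebra.ι k (.inr ⁅X, Y⁆))
      (FreeAlgebra.ι k (.inr X) * FreeAlgebra.ι k (.inr Y)
        - FreeAlgebra.ι k (.inr Y) * FreeAlgebra.ι k (.inr X))
  | base_smul (a : A) (X : g) : Rel k A g (FreeAlgebra.ι k (.inr (a • X)))
      (FreeAlgebra.ι k (.inl a) * FreeAlgebra.ι k (.inr X))
  | anchor (X : g) (a : A) : Rel k A g
      (FreeAlgebra.ι k (.inr X) * FreeAlgebra.ι k (.inl a)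
        - FreeAlgebra.ι k (.inl a) * FreeAlgebra.ι k (.inr X))
      (FreeAlgebra.ι k (.inl ⁅X, a⁆))

end LRUniversalEnveloping

/-- The universal enveloping algebra `U_A(g)` of a Lie-Rinehart algebra `(A, g, ω)` over `k`. -/
def LRUniversalEnveloping (k A g : Type*) [CommRing k] [CommRing A] [Algebra k A] [LieRing g]
    [LieAlgebra k g] [Module A g] [LieRingModule g A] : Type _ :=
  RingQuot (LRUniversalEnveloping.Rel k A g)

namespace LRUniversalEnveloping

noncomputable section

section Basic

variable (k A g : Type*) [CommRing k] [CommRing A] [Algebra k A] [LieRing g]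
    [LieAlgebra k g] [Module A g] [LieRingModule g A]

instance instRing : Ring (LRUniversalEnveloping k A g) :=
  inferInstanceAs (Ring (RingQuot (Rel k A g)))

instance instAlgebra : Algebra k (LRUniversalEnveloping k A g) :=
  inferInstanceAs (Algebra k (RingQuot (Rel k A g)))

/-- The quotient map from the free algebra. -/
def mk : FreeAlgebra k (A ⊕ g) →ₐ[k] LRUniversalEnveloping k A g :=
  RingQuot.mkAlgHom k (Rel k A g)

variable {k A g} in
theorem mk_rel {x y : FreeAlgebra k (A ⊕ g)} (h : Rel k A g x y) : mk k A g x = mk k A g y :=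
  RingQuot.mkAlgHom_rel k h

/-- The algebra morphism `ι_A : A → U_A(g)`. -/
def ofBase : A →ₐ[k] LRUniversalEnveloping k A g :=
  AlgHom.mk'
    { toFun := fun a => mk k A g (FreeAlgebra.ι k (.inl a))
      map_one' := by
        have h := mk_rel (Rel.scalar (k := k) (A := A) (g := g) 1)
        simpa using h
      map_mul' := fun a b => by simpa using mk_rel (Rel.base_mul (k := k) (g := g) a b)
      map_zero' := by
        have h := mk_rel (Rel.scalar (k := k) (A := A) (g := g) 0)
        simpa using h
      map_add' := fun a b => by simpa using mk_rel (Rel.base_add (k := k) (g := g) a b) }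
    (fun r a => by
      have h := mk_rel (Rel.base_mul (k := k) (g := g) (algebraMap k A r) a)
      have h' := mk_rel (Rel.scalar (k := k) (A := A) (g := g) r)
      rw [map_mul, h', AlgHom.commutes] at h
      simpa [Algebra.smul_def] using h)

/-- The Lie algebra morphism `ι_g : g → U_A(g)`, as a `k`-linear map; see `ofLie_lie`. -/
def ofLie : g →ₗ[k] LRUniversalEnveloping k A g where
  toFun X := mk k A g (FreeAlgebra.ι k (.inr X))
  map_add' X Y := by simpa using mk_rel (Rel.lie_add (k := k) (A := A) X Y)
  map_smul' r X := by simpa using mk_rel (Rel.lie_smul (k := k) (A := A) r X)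

variable {k A g}

theorem ofLie_lie (X Y : g) : ofLie k A g ⁅X, Y⁆
    = ofLie k A g X * ofLie k A g Y - ofLie k A g Y * ofLie k A g X := by
  simpa [ofLie] using mk_rel (Rel.lie_bracket (k := k) (A := A) X Y)

theorem ofLie_smul (a : A) (X : g) :
    ofLie k A g (a • X) = ofBase k A g a * ofLie k A g X := by
  simpa [ofLie, ofBase] using mk_rel (Rel.base_smul (k := k) a X)

theorem ofLie_mul_ofBase (X : g) (a : A) :
    ofLie k A g X * ofBase k A g a
      = ofBase k A g a * ofLie k A g X + ofBase k A g ⁅X, a⁆ := by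
  have h := mk_rel (Rel.anchor (k := k) X a)
  rw [map_sub, map_mul, map_mul] at h
  exact sub_eq_iff_eq_add'.1 h

/-- The universal property of `U_A(g)`: existence. -/
def lift {R : Type*} [Ring R] [Algebra k R] (fA : A →ₐ[k] R) (fg : g →ₗ[k] R)
    (h_lie : ∀ X Y : g, fg ⁅X, Y⁆ = fg X * fg Y - fg Y * fg X)
    (h_smul : ∀ (a : A) (X : g), fg (a • X) = fA a * fg X)
    (h_anchor : ∀ (X : g) (a : A), fg X * fA a - fA a * fg X = fA ⁅X, a⁆) :
    LRUniversalEnveloping k A g →ₐ[k] R :=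
  RingQuot.liftAlgHom k
    ⟨FreeAlgebra.lift k (Sum.elim fA fg), by
      intro x y h
      induction h <;> simp [h_lie, h_smul, h_anchor]⟩

section lift

variable {R : Type*} [Ring R] [Algebra k R] (fA : A →ₐ[k] R) (fg : g →ₗ[k] R)
    (h_lie : ∀ X Y : g, fg ⁅X, Y⁆ = fg X * fg Y - fg Y * fg X)
    (h_smul : ∀ (a : A) (X : g), fg (a • X) = fA a * fg X)
    (h_anchor : ∀ (X : g) (a : A), fg X * fA a - fA a * fg X = fA ⁅X, a⁆)

theorem lift_ofBase (a : A) :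
    lift fA fg h_lie h_smul h_anchor (ofBase k A g a) = fA a := by
  refine (RingQuot.liftAlgHom_mkAlgHom_apply k _ _ _).trans ?_
  simp

theorem lift_ofLie (X : g) :
    lift fA fg h_lie h_smul h_anchor (ofLie k A g X) = fg X := by
  refine (RingQuot.liftAlgHom_mkAlgHom_apply k _ _ _).trans ?_
  simp

end lift

/-- The universal property of `U_A(g)`: uniqueness. -/
theorem hom_ext {R : Type*} [Ring R] [Algebra k R] {F G : LRUniversalEnveloping k A g →ₐ[k] R}
    (h₁ : ∀ a, F (ofBase k A g a) = G (ofBase k A g a))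
    (h₂ : ∀ X, F (ofLie k A g X) = G (ofLie k A g X)) : F = G := by
  refine RingQuot.ringQuot_ext' k F G (FreeAlgebra.hom_ext (funext fun s => ?_))
  cases s with
  | inl a => exact h₁ a
  | inr X => exact h₂ X

/-- The left `A`-module structure `a • u = ι_A(a) u`. -/
instance instModuleBase : Module A (LRUniversalEnveloping k A g) :=
  Module.compHom _ (ofBase k A g : A →+* LRUniversalEnveloping k A g)

theorem base_smul_def (a : A) (u : LRUniversalEnveloping k A g) :
    a • u = ofBase k A g a * u := rfl

instance instIsScalarTower : IsScalarTower k A (LRUniversalEnveloping k A g) where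
  smul_assoc r a u := by
    rw [base_smul_def, base_smul_def, map_smul, smul_mul_assoc]

theorem induction {p : LRUniversalEnveloping k A g → Prop} (one : p 1)
    (add : ∀ u v, p u → p v → p (u + v)) (smul : ∀ (a : A) u, p u → p (a • u))
    (lie : ∀ (X : g) u, p u → p (ofLie k A g X * u)) (u : LRUniversalEnveloping k A g) : p u := by
  suffices h : ∀ x : FreeAlgebra k (A ⊕ g), ∀ v, p v → p (mk k A g x * v) by
    obtain ⟨x, rfl⟩ := RingQuot.mkAlgHom_surjective k (Rel k A g) u
    have h' := h x 1 one
    rwa [mul_one] at h'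
  intro x
  induction x using FreeAlgebra.induction with
  | grade0 r =>
    intro v hv
    have h := smul (algebraMap k A r) v hv
    rwa [base_smul_def, AlgHom.commutes, ← AlgHom.commutes (mk k A g)] at h
  | grade1 s =>
    intro v hv
    cases s with
    | inl a => exact smul a v hv
    | inr X => exact lie X v hv
  | mul x y hx hy =>
    intro v hv
    rw [map_mul, mul_assoc]
    exact hx _ (hy _ hv)
  | add x y hx hy =>
    intro v hv
    rw [map_add, add_mul]
    exact add _ _ (hx _ hv) (hy _ hv)

end Basic

/-! ### The coalgebra structure

An operator `f` on an `A`-module with `f (a • m) = a • f m + δ a • m` is a derivation over `δ`.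
Two such operators over the same `δ` induce `m ⊗ n ↦ f m ⊗ n + m ⊗ h n` on the tensor product. -/

section Leibniz

variable {k A : Type*} [CommRing k] [CommRing A]
  {M N : Type*} [AddCommGroup M] [Module k M] [Module A M]
  [AddCommGroup N] [Module k N] [Module A N]

/-- The operator `m ⊗ n ↦ f m ⊗ n + m ⊗ h n` on `M ⊗[A] N`, as an additive map. -/
def leibnizTensorAux (δ : A → A) (f : Module.End k M) (h : Module.End k N)
    (hf : ∀ (a : A) m, f (a • m) = a • f m + δ a • m)
    (hh : ∀ (a : A) n, h (a • n) = a • h n + δ a • n) : M ⊗[A] N →+ M ⊗[A] N :=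
  TensorProduct.liftAddHom (R := A)
    (AddMonoidHom.mk' (fun m => AddMonoidHom.mk' (fun n => f m ⊗ₜ[A] n + m ⊗ₜ[A] h n)
      (fun n n' => by simp only [map_add, TensorProduct.tmul_add]; abel))
      (fun m m' => by
        ext n
        simp only [map_add, TensorProduct.add_tmul, AddMonoidHom.mk'_apply,
          AddMonoidHom.add_apply]
        abel))
    (fun a m n => by
      simp only [AddMonoidHom.mk'_apply, hf, hh, TensorProduct.add_tmul, TensorProduct.tmul_add,
        TensorProduct.smul_tmul]
      abel)

theorem leibnizTensorAux_tmul {δ : A → A} {f : Module.End k M} {h : Module.End k N}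
    {hf : ∀ (a : A) m, f (a • m) = a • f m + δ a • m}
    {hh : ∀ (a : A) n, h (a • n) = a • h n + δ a • n} (m : M) (n : N) :
    leibnizTensorAux δ f h hf hh (m ⊗ₜ n) = f m ⊗ₜ n + m ⊗ₜ h n := rfl

variable [Algebra k A] [IsScalarTower k A M]

/-- The operator `m ⊗ n ↦ f m ⊗ n + m ⊗ h n` on `M ⊗[A] N`. -/
def leibnizTensor (δ : A → A) (f : Module.End k M) (h : Module.End k N)
    (hf : ∀ (a : A) m, f (a • m) = a • f m + δ a • m)
    (hh : ∀ (a : A) n, h (a • n) = a • h n + δ a • n) : Module.End k (M ⊗[A] N) where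
  toFun := leibnizTensorAux δ f h hf hh
  map_add' := map_add _
  map_smul' := fun r x => by
    induction x using TensorProduct.induction_on with
    | zero => simp
    | tmul m n =>
      simp only [TensorProduct.smul_tmul', leibnizTensorAux_tmul, map_smul, smul_add,
        RingHom.id_apply]
    | add x y hx hy => rw [smul_add, map_add, hx, hy, map_add, smul_add]

variable {δ : A → A} {f : Module.End k M} {h : Module.End k N}
    {hf : ∀ (a : A) m, f (a • m) = a • f m + δ a • m}
    {hh : ∀ (a : A) n, h (a • n) = a • h n + δ a • n}

@[simp]
theorem leibnizTensor_tmul (m : M) (n : N) :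
    leibnizTensor δ f h hf hh (m ⊗ₜ n) = f m ⊗ₜ n + m ⊗ₜ h n := rfl

theorem leibnizTensor_smul (a : A) (x : M ⊗[A] N) :
    leibnizTensor δ f h hf hh (a • x) = a • leibnizTensor δ f h hf hh x + δ a • x := by
  induction x using TensorProduct.induction_on with
  | zero => simp
  | tmul m n =>
    simp only [TensorProduct.smul_tmul', leibnizTensor_tmul, hf, TensorProduct.add_tmul, smul_add]
    abel
  | add x y hx hy => simp only [smul_add, map_add, hx, hy]; abel

end Leibniz

section Coalgebra

variable {k A g : Type*} [CommRing k] [CommRing A] [Algebra k A] [LieRing g]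
    [LieAlgebra k g] [Module A g] [LieRingModule g A]

variable (k A) in
/-- Left multiplication by `X` on `U_A(g)`. -/
def lieMul (X : g) : Module.End k (LRUniversalEnveloping k A g) :=
  LinearMap.mulLeft k (ofLie k A g X)

theorem lieMul_apply (X : g) (u : LRUniversalEnveloping k A g) :
    lieMul k A X u = ofLie k A g X * u := rfl

theorem lieMul_smul (X : g) (a : A) (u : LRUniversalEnveloping k A g) :
    lieMul k A X (a • u) = a • lieMul k A X u + ⁅X, a⁆ • u := by
  simp only [lieMul_apply, base_smul_def, ← mul_assoc, ofLie_mul_ofBase, add_mul]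

variable (k A) in
/-- The diagonal action `u ⊗ v ↦ X u ⊗ v + u ⊗ X v` of `X` on `U ⊗[A] U`. -/
def lieTensor (X : g) :
    Module.End k (LRUniversalEnveloping k A g ⊗[A] LRUniversalEnveloping k A g) :=
  leibnizTensor (fun a => ⁅X, a⁆) (lieMul k A X) (lieMul k A X) (lieMul_smul X) (lieMul_smul X)

theorem lieTensor_tmul (X : g) (u v : LRUniversalEnveloping k A g) :
    lieTensor k A X (u ⊗ₜ v) = (ofLie k A g X * u) ⊗ₜ v + u ⊗ₜ (ofLie k A g X * v) := rfl

variable (k A g) in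
/-- The action of `U_A(g)` on `U ⊗[A] U` that extends the diagonal action of `g`. -/
def tensorAction : LRUniversalEnveloping k A g →ₐ[k]
    Module.End k (LRUniversalEnveloping k A g ⊗[A] LRUniversalEnveloping k A g) :=
  lift (Algebra.lsmul k k _)
    { toFun := lieTensor k A
      map_add' := fun X Y => by
        ext x
        induction x using TensorProduct.induction_on with
        | zero => simp
        | tmul u v =>
          simp only [lieTensor_tmul, LinearMap.add_apply, map_add, add_mul,
            TensorProduct.add_tmul, TensorProduct.tmul_add]
          abel
        | add x y hx hy => simp only [map_add, hx, hy]
      map_smul' := fun r X => by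
        ext x
        induction x using TensorProduct.induction_on with
        | zero => simp
        | tmul u v =>
          simp only [lieTensor_tmul, LinearMap.smul_apply, map_smul, smul_mul_assoc,
            RingHom.id_apply, smul_add, TensorProduct.smul_tmul', TensorProduct.tmul_smul]
        | add x y hx hy => simp only [map_add, hx, hy] }
    (fun X Y => by
      ext x
      induction x using TensorProduct.induction_on with
      | zero => simp
      | tmul u v =>
        simp only [lieTensor_tmul, LinearMap.coe_mk, AddHom.coe_mk, LinearMap.sub_apply,
          Module.End.mul_apply, ofLie_lie, map_add, sub_mul, TensorProduct.sub_tmul,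
          TensorProduct.tmul_sub, mul_assoc]
        abel
      | add x y hx hy => simp only [map_add, hx, hy])
    (fun a X => by
      ext x
      induction x using TensorProduct.induction_on with
      | zero => simp
      | tmul u v =>
        simp only [lieTensor_tmul, LinearMap.coe_mk, AddHom.coe_mk, Module.End.mul_apply,
          Algebra.lsmul_coe, ofLie_smul, mul_assoc, smul_add]
        rw [← base_smul_def, ← base_smul_def, TensorProduct.smul_tmul', TensorProduct.tmul_smul]
      | add x y hx hy => simp only [map_add, hx, hy])
    (fun X a => by
      ext x
      simp only [LinearMap.coe_mk, AddHom.coe_mk, Module.End.mul_apply, Algebra.lsmul_coe,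
        LinearMap.sub_apply]
      rw [lieTensor, leibnizTensor_smul, add_sub_cancel_left])

variable (k A g) in
/-- The comultiplication `Δ : U → U ⊗[A] U`: the left `A`-linear map with `Δ(1) = 1 ⊗ 1` and
`Δ(X u) = (X ⊗ 1 + 1 ⊗ X) Δ(u)`; see `comul_one` and `comul_lie_mul`. -/
def comul : LRUniversalEnveloping k A g →ₗ[A]
    LRUniversalEnveloping k A g ⊗[A] LRUniversalEnveloping k A g where
  toFun u := tensorAction k A g u (1 ⊗ₜ 1)
  map_add' u v := by simp
  map_smul' a u := by
    rw [base_smul_def, map_mul, Module.End.mul_apply, tensorAction, lift_ofBase]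
    rfl

theorem comul_one : comul k A g 1 = 1 ⊗ₜ 1 := by simp [comul]

theorem comul_lie_mul (X : g) (u : LRUniversalEnveloping k A g) :
    comul k A g (ofLie k A g X * u) = lieTensor k A X (comul k A g u) := by
  simp only [comul, LinearMap.coe_mk, AddHom.coe_mk, map_mul, Module.End.mul_apply]
  rw [tensorAction, lift_ofLie]
  rfl

theorem coassoc_aux (u : LRUniversalEnveloping k A g) :
    TensorProduct.assoc A _ _ _ ((comul k A g).rTensor _ (comul k A g u))
      = (comul k A g).lTensor _ (comul k A g u) := by
  induction u using induction with
  | one => simp [comul_one]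
  | add u v hu hv => simp only [map_add, hu, hv]
  | smul a u hu => simp only [map_smul, hu]
  | lie X u hu =>
    -- the diagonal operators of `X` on the two triple tensor products
    let D₁ := leibnizTensor (fun a => ⁅X, a⁆) (lieTensor k A X) (lieMul k A X)
      (leibnizTensor_smul (hf := lieMul_smul X) (hh := lieMul_smul X)) (lieMul_smul X)
    let D₂ := leibnizTensor (fun a => ⁅X, a⁆) (lieMul k A X) (lieTensor k A X)
      (lieMul_smul X) (leibnizTensor_smul (hf := lieMul_smul X) (hh := lieMul_smul X))
    have hD₁ : ∀ x w, D₁ (x ⊗ₜ w) = lieTensor k A X x ⊗ₜ w + x ⊗ₜ (ofLie k A g X * w) :=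
      fun _ _ => rfl
    have hD₂ : ∀ w x, D₂ (w ⊗ₜ x) = (ofLie k A g X * w) ⊗ₜ x + w ⊗ₜ lieTensor k A X x :=
      fun _ _ => rfl
    have h₁ : ∀ t, (comul k A g).rTensor _ (lieTensor k A X t)
        = D₁ ((comul k A g).rTensor _ t) := by
      intro t
      induction t using TensorProduct.induction_on with
      | zero => simp
      | tmul u v => simp [hD₁, lieTensor_tmul, comul_lie_mul]
      | add x y hx hy => simp only [map_add, hx, hy]
    have h₂ : ∀ t, (comul k A g).lTensor _ (lieTensor k A X t)
        = D₂ ((comul k A g).lTensor _ t) := by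
      intro t
      induction t using TensorProduct.induction_on with
      | zero => simp
      | tmul u v => simp [hD₂, lieTensor_tmul, comul_lie_mul]
      | add x y hx hy => simp only [map_add, hx, hy]
    have h₃ : ∀ t, TensorProduct.assoc A _ _ _ (D₁ t) = D₂ (TensorProduct.assoc A _ _ _ t) := by
      intro t
      induction t using TensorProduct.induction_on with
      | zero => simp
      | tmul x w =>
        induction x using TensorProduct.induction_on with
        | zero => simp
        | tmul u v =>
          simp only [hD₁, hD₂, lieTensor_tmul, TensorProduct.assoc_tmul, TensorProduct.add_tmul,
            TensorProduct.tmul_add, map_add]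
          abel
        | add x y hx hy => simp only [TensorProduct.add_tmul, map_add, hx, hy]
      | add x y hx hy => simp only [map_add, hx, hy]
    rw [comul_lie_mul, h₁, h₂, h₃, hu]

variable [LieRinehartRing A g] [LieRinehartAlgebra k A g]

variable (k A g) in
/-- The action of `U_A(g)` on `A` that extends multiplication and the anchor. -/
def baseAction : LRUniversalEnveloping k A g →ₐ[k] Module.End k A :=
  lift (Algebra.lmul k A) (LieModule.toEnd k g A : g →ₗ[k] Module.End k A)
    (fun X Y => by ext a; simp)
    (fun a X => by ext b; simp)
    (fun X a => by ext b; simp)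

variable (k A g) in
/-- The counit `ε : U → A`: the left `A`-linear map with `ε(1) = 1` and `ε(X u) = ω(X)(ε(u))`;
in particular `ε(X₁ ⋯ Xₙ) = 0` for `n ≥ 1`. -/
def counit : LRUniversalEnveloping k A g →ₗ[A] A where
  toFun u := baseAction k A g u 1
  map_add' u v := by simp
  map_smul' a u := by
    rw [base_smul_def, map_mul, Module.End.mul_apply, baseAction, lift_ofBase]
    rfl

theorem counit_one : counit k A g 1 = 1 := by simp [counit]

theorem counit_lie_mul (X : g) (u : LRUniversalEnveloping k A g) :
    counit k A g (ofLie k A g X * u) = ⁅X, counit k A g u⁆ := by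
  simp only [counit, LinearMap.coe_mk, AddHom.coe_mk, map_mul, Module.End.mul_apply]
  rw [baseAction, lift_ofLie]
  rfl

theorem rTensor_counit_aux (u : LRUniversalEnveloping k A g) :
    (counit k A g).rTensor _ (comul k A g u) = 1 ⊗ₜ[A] u := by
  induction u using induction with
  | one => simp [comul_one, counit_one]
  | add u v hu hv => simp only [map_add, hu, hv, TensorProduct.tmul_add]
  | smul a u hu => simp only [map_smul, hu, TensorProduct.tmul_smul]
  | lie X u hu =>
    let D := leibnizTensor (k := k) (fun a => ⁅X, a⁆) (LieModule.toEnd k g A X) (lieMul k A X)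
      (fun a b => by simp) (lieMul_smul X)
    have h : ∀ t, (counit k A g).rTensor _ (lieTensor k A X t)
        = D ((counit k A g).rTensor _ t) := by
      intro t
      induction t using TensorProduct.induction_on with
      | zero => simp
      | tmul u v => simp [D, lieTensor_tmul, counit_lie_mul, lieMul_apply]
      | add x y hx hy => simp only [map_add, hx, hy]
    have h1 : ⁅X, (1 : A)⁆ = 0 := by
      simpa using LieRinehartRing.leibniz_mul_right X (1 : A) 1
    rw [comul_lie_mul, h, hu]
    simp [D, h1, lieMul_apply]

theorem lTensor_counit_aux (u : LRUniversalEnveloping k A g) :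
    (counit k A g).lTensor _ (comul k A g u) = u ⊗ₜ[A] 1 := by
  induction u using induction with
  | one => simp [comul_one, counit_one]
  | add u v hu hv => simp only [map_add, hu, hv, TensorProduct.add_tmul]
  | smul a u hu => simp only [map_smul, hu, TensorProduct.smul_tmul']
  | lie X u hu =>
    let D := leibnizTensor (k := k) (fun a => ⁅X, a⁆) (lieMul k A X) (LieModule.toEnd k g A X)
      (lieMul_smul X) (fun a b => by simp)
    have h : ∀ t, (counit k A g).lTensor _ (lieTensor k A X t)
        = D ((counit k A g).lTensor _ t) := by
      intro t
      induction t using TensorProduct.induction_on with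
      | zero => simp
      | tmul u v => simp [D, lieTensor_tmul, counit_lie_mul, lieMul_apply]
      | add x y hx hy => simp only [map_add, hx, hy]
    have h1 : ⁅X, (1 : A)⁆ = 0 := by
      simpa using LieRinehartRing.leibniz_mul_right X (1 : A) 1
    rw [comul_lie_mul, h, hu]
    simp [D, h1, lieMul_apply]

/-- The `A`-coalgebra structure of `U_A(g)`, over the left `A`-module structure. -/
instance instCoalgebra : Coalgebra A (LRUniversalEnveloping k A g) where
  comul := comul k A g
  counit := counit k A g
  coassoc := LinearMap.ext coassoc_aux
  rTensor_counit_comp_comul := LinearMap.ext rTensor_counit_aux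
  lTensor_counit_comp_comul := LinearMap.ext lTensor_counit_aux

end Coalgebra

end

end LRUniversalEnveloping

/-! ### Projective bases and the symmetrisation map -/

/-- A projective (dual) basis `{χ_i, φ_i}` of an `A`-module `g`. -/
structure ProjectiveBasis (I A g : Type*) [CommRing A] [AddCommGroup g] [Module A g] where
  /-- the generators `χ_i` -/
  gen : I → g
  /-- the linear forms `φ_i` -/
  form : I → g →ₗ[A] A
  finite_support : ∀ X : g, (Function.support fun i => form i X).Finite
  sum_form_smul_gen : ∀ X : g, ∑ᶠ i, form i X • gen i = X

namespace ProjectiveBasis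

noncomputable section

/-- Every projective module has a projective basis. -/
theorem exists_of_projective (A g : Type*) [CommRing A] [AddCommGroup g] [Module A g]
    [Module.Projective A g] : Nonempty (ProjectiveBasis g A g) := by
  obtain ⟨s, hs⟩ := (Module.projective_def' (R := A) (P := g)).1 inferInstance
  refine ⟨⟨id, fun i => Finsupp.lapply i ∘ₗ s, fun X => (s X).hasFiniteSupport, fun X => ?_⟩⟩
  have h := LinearMap.congr_fun hs X
  simp only [LinearMap.comp_apply, Finsupp.linearCombination_apply, LinearMap.id_apply] at h
  rw [Finsupp.sum] at h
  conv_rhs => rw [← h]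
  refine finsum_eq_sum_of_support_subset _ fun i hi => ?_
  simp only [Function.mem_support, Finsupp.lapply_apply, LinearMap.comp_apply] at hi
  simp only [Finset.mem_coe, Finsupp.mem_support_iff]
  exact fun h0 => hi (by rw [h0, zero_smul])

variable {I A g : Type*} [CommRing A] [AddCommGroup g] [Module A g] (b : ProjectiveBasis I A g)

/-- The finite set of the indices `i` with `φ_i(X) ≠ 0`. -/
def supp (X : g) : Finset I := (b.finite_support X).toFinset

/-- The morphism `S_A(g) → A[x_i | i ∈ I]` of `A`-algebras with `X ↦ ∑ φ_i(X) x_i`. -/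
def toPolynomial : SymmetricAlgebra A g →ₐ[A] MvPolynomial I A :=
  SymmetricAlgebra.lift
    { toFun := fun X => ∑ᶠ i, b.form i X • MvPolynomial.X i
      map_add' := fun X Y => by
        simp only [map_add, add_smul]
        exact finsum_add_distrib
          ((b.finite_support X).subset fun i hi h0 => hi (by simp only at h0; simp [h0]))
          ((b.finite_support Y).subset fun i hi h0 => hi (by simp only at h0; simp [h0]))
      map_smul' := fun a X => by
        simp only [map_smul, smul_assoc, RingHom.id_apply]
        exact (smul_finsum' a
          ((b.finite_support X).subset fun i hi h0 => hi (by simp only at h0; simp [h0]))).symm }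

/-- The average `(1/n!) ∑_σ u_{σ(1)} ⋯ u_{σ(n)}` of the products of `u_1, …, u_n` in all orders. -/
def averagedProduct (k : Type*) [Field k] {U : Type*} [Ring U] [Algebra k U] {n : ℕ}
    (u : Fin n → U) : U :=
  (n.factorial : k)⁻¹ • ∑ σ : Equiv.Perm (Fin n), (List.ofFn fun i => u (σ i)).prod

end

end ProjectiveBasis

namespace ProjectiveBasis

noncomputable section

variable {I A g : Type*} [CommRing A] [LieRing g] [Module A g] (b : ProjectiveBasis I A g)
  (k : Type*) [Field k] [Algebra k A] [LieAlgebra k g] [LieRingModule g A]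

open LRUniversalEnveloping

/-- The `A`-linear map `A[x_i | i ∈ I] → U_A(g)` that sends a monomial `x_{j_1} ⋯ x_{j_n}` to
the average of the products of `χ_{j_1}, …, χ_{j_n}` in all orders. -/
def averageMonomials : MvPolynomial I A →ₗ[A] LRUniversalEnveloping k A g :=
  (MvPolynomial.basisMonomials I A).constr A fun m =>
    averagedProduct k fun i => ofLie k A g (b.gen (m.toMultiset.toList.get i))

/-- The symmetrisation map `S_A(g) → U_A(g)` of a projective basis; it is characterised by
`symmetrisation_prod`. -/
def symmetrisation : SymmetricAlgebra A g →ₗ[A] LRUniversalEnveloping k A g :=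
  b.averageMonomials k ∘ₗ b.toPolynomial.toLinearMap

theorem averagedProduct_comp_equiv {U : Type*} [Ring U] [Algebra k U] {m n : ℕ}
    (e : Fin m ≃ Fin n) (u : Fin n → U) :
    averagedProduct k (fun i => u (e i)) = averagedProduct k u := by
  obtain rfl : m = n := by simpa using Fintype.card_congr e
  unfold averagedProduct
  congr 1
  exact Fintype.sum_equiv (Equiv.mulLeft e) _ _ fun σ => rfl

theorem averagedProduct_congr {U : Type*} [Ring U] [Algebra k U] {l : List I} {n : ℕ}
    (j : Fin n → I) (h : l.Perm (List.ofFn j)) (f : I → U) :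
    averagedProduct k (fun i => f (l.get i)) = averagedProduct k (fun i => f (j i)) := by
  classical
  let e : Fin l.length ≃ Fin (List.ofFn j).length :=
    ⟨h.idxBij, h.symm.idxBij, h.symm.idxBij_leftInverse_idxBij_symm,
      h.symm.idxBij_rightInverse_idxBij_symm⟩
  have he : ∀ i, j (finCongr (List.length_ofFn (f := j)) (e i)) = l.get i := fun i => by
    have h' := h.getElem_idxBij_eq_getElem (i := i)
    rw [List.getElem_ofFn] at h'
    exact h'
  rw [← averagedProduct_comp_equiv k (e.trans (finCongr (List.length_ofFn (f := j))))]
  simp only [Equiv.trans_apply, he]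

theorem averageMonomials_prod {n : ℕ} (j : Fin n → I) :
    b.averageMonomials k (∏ i, MvPolynomial.X (j i))
      = averagedProduct k fun i => ofLie k A g (b.gen (j i)) := by
  have h : (∏ i, MvPolynomial.X (j i) : MvPolynomial I A)
      = MvPolynomial.basisMonomials I A (∑ i, Finsupp.single (j i) 1) := by
    rw [MvPolynomial.coe_basisMonomials]
    exact (MvPolynomial.monomial_sum_one _ _).symm
  rw [h, averageMonomials, Module.Basis.constr_basis]
  refine averagedProduct_congr k j ?_ fun i => ofLie k A g (b.gen i)
  rw [← Multiset.coe_eq_coe, Multiset.coe_toList, ← Fin.univ_val_map, Finsupp.toMultiset_sum]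
  simp only [Finsupp.toMultiset_single, one_smul]
  rw [← Multiset.sum_map_singleton (Multiset.map j Finset.univ.val), Multiset.map_map]
  rfl

/-- The defining formula of the symmetrisation map, for `n ≥ 0`. -/
theorem symmetrisation_prod {n : ℕ} (X : Fin n → g) :
    b.symmetrisation k (∏ i, SymmetricAlgebra.ι A g (X i))
      = (n.factorial : k)⁻¹ • ∑ j ∈ Fintype.piFinset fun i => b.supp (X i),
          ∑ σ : Equiv.Perm (Fin n), (∏ i, b.form (j i) (X i)) •
            (List.ofFn fun i => ofLie k A g (b.gen (j (σ i)))).prod := by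
  have h : ∀ Y : g, b.toPolynomial (SymmetricAlgebra.ι A g Y)
      = ∑ i ∈ b.supp Y, b.form i Y • MvPolynomial.X i := fun Y => by
    rw [toPolynomial, SymmetricAlgebra.lift_ι_apply]
    refine finsum_eq_sum_of_support_subset _ fun i hi => ?_
    simp only [supp, Set.Finite.coe_toFinset]
    exact fun h0 => hi (by simp only at h0; simp [h0])
  simp only [symmetrisation, LinearMap.comp_apply, AlgHom.toLinearMap_apply, map_prod, h,
    Finset.prod_univ_sum, Finset.prod_smul, map_sum, map_smul, averageMonomials_prod,
    averagedProduct]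
  rw [Finset.smul_sum]
  refine Finset.sum_congr rfl fun j _ => ?_
  rw [smul_comm, Finset.smul_sum]

end

end ProjectiveBasis

/-!
Embed the projective module `g` in a Lie-Rinehart algebra which is free as a module: a semidirect
product with a free module with trivial connection, by the Eilenberg swindle. On the polynomials in
a basis of the latter, straightening defines a connection, whose flatness follows from the Bianchi
identity by induction on the degree; so `U_A(g)` acts on them. Applying this action to `1` and
projecting to `S_A(g)` gives a symbol map. The symbol map and the symmetrisation both send a product
of elements of `g` to the same product up to shorter ones, so the symmetrisation is bijective.

By polarisation, compatibility with the coalgebra structures needs checking only on powers of sums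
of variables, and averaging sends `(∑ x_j) ^ n` to `(∑ χ_j) ^ n`.
-/

section Unitriangular

open Submodule

variable {R W M N : Type*} [Ring R] [AddCommGroup M] [Module R M] [AddCommGroup N] [Module R N]
  {deg : W → ℕ} {v : W → M} {v' : W → N} {n : ℕ}

variable (R) in
/-- The `R`-linear span of the `v w` with `deg w < n`. For varying `n` these submodules form the
filtration of `M` induced by a degree function on a generating family. -/
def spanBelow (deg : W → ℕ) (v : W → M) (n : ℕ) : Submodule R M :=
  span R (v '' {w | deg w < n})

theorem apply_mem_spanBelow {w : W} (h : deg w < n) : v w ∈ spanBelow R deg v n :=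
  subset_span ⟨w, h, rfl⟩

theorem spanBelow_le {N : Submodule R M} :
    spanBelow R deg v n ≤ N ↔ ∀ w, deg w < n → v w ∈ N := by
  simp [spanBelow, span_le, Set.subset_def]

theorem spanBelow_mono : Monotone (spanBelow R deg v) :=
  fun _ _ hmn => spanBelow_le.2 fun _ hw => apply_mem_spanBelow (hw.trans_le hmn)

theorem spanBelow_zero : spanBelow R deg v 0 = ⊥ := by simp [spanBelow]

theorem exists_mem_spanBelow (hv : span R (Set.range v) = ⊤) (x : M) :
    ∃ n, x ∈ spanBelow R deg v n := by
  have h : span R (Set.range v) ≤ ⨆ n, spanBelow R deg v n := by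
    rw [span_le]
    rintro _ ⟨w, rfl⟩
    exact mem_iSup_of_mem (deg w + 1) (apply_mem_spanBelow (Nat.lt_succ_self _))
  exact (mem_iSup_of_directed _ spanBelow_mono.directed_le).1 (h (hv ▸ mem_top))

/-- A linear map sending each `v w` to `v' w`, up to terms of smaller degree. -/
def IsUnitriangular (deg : W → ℕ) (v : W → M) (v' : W → N) (φ : M →ₗ[R] N) : Prop :=
  ∀ w, φ (v w) - v' w ∈ spanBelow R deg v' (deg w)

namespace IsUnitriangular

variable {φ : M →ₗ[R] N} {ψ : N →ₗ[R] M}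

theorem apply_mem (hφ : IsUnitriangular deg v v' φ) {x : M} (hx : x ∈ spanBelow R deg v n) :
    φ x ∈ spanBelow R deg v' n := by
  suffices spanBelow R deg v n ≤ (spanBelow R deg v' n).comap φ from this hx
  refine spanBelow_le.2 fun w hw => ?_
  rw [mem_comap, ← sub_add_cancel (φ (v w)) (v' w)]
  exact add_mem (spanBelow_mono hw.le (hφ w)) (apply_mem_spanBelow hw)

theorem comp (hψ : IsUnitriangular deg v' v ψ) (hφ : IsUnitriangular deg v v' φ) :
    IsUnitriangular deg v v (ψ ∘ₗ φ) := fun w => by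
  rw [LinearMap.comp_apply, ← sub_add_sub_cancel (ψ (φ (v w))) (ψ (v' w)) (v w), ← map_sub]
  exact add_mem (hψ.apply_mem (hφ w)) (hψ w)

theorem surjective (hφ : IsUnitriangular deg v v' φ) (hv' : span R (Set.range v') = ⊤) :
    Function.Surjective φ := by
  have h : ∀ n, spanBelow R deg v' n ≤ LinearMap.range φ := by
    intro n
    induction n with
    | zero => simp only [spanBelow_zero, bot_le]
    | succ n ih =>
      refine spanBelow_le.2 fun w hw => ?_
      rw [← sub_sub_cancel (φ (v w)) (v' w)]
      exact sub_mem ⟨v w, rfl⟩ (ih (spanBelow_mono (Nat.lt_succ_iff.1 hw) (hφ w)))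
  intro y
  obtain ⟨n, hn⟩ := exists_mem_spanBelow hv' y
  exact h n hn

theorem injective_of_endomorphism {φ : M →ₗ[R] M} (hφ : IsUnitriangular deg v v φ)
    (hv : span R (Set.range v) = ⊤) : Function.Injective φ := by
  have hsub : ∀ n, spanBelow R deg v (n + 1) ≤ (spanBelow R deg v n).comap (φ - .id) :=
    fun n => spanBelow_le.2 fun w hw => spanBelow_mono (Nat.lt_succ_iff.1 hw) (hφ w)
  rw [injective_iff_map_eq_zero]
  intro x hx
  obtain ⟨n, hn⟩ := exists_mem_spanBelow hv x
  induction n with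
  | zero => simpa only [spanBelow_zero, mem_bot] using hn
  | succ n ih =>
    have h : φ x - x ∈ spanBelow R deg v n := hsub n hn
    rw [hx, zero_sub, neg_mem_iff] at h
    exact ih h

theorem bijective (hφ : IsUnitriangular deg v v' φ) (hψ : IsUnitriangular deg v' v ψ)
    (hv : span R (Set.range v) = ⊤) (hv' : span R (Set.range v') = ⊤) : Function.Bijective φ :=
  ⟨.of_comp (f := ψ) ((hψ.comp hφ).injective_of_endomorphism hv), hφ.surjective hv'⟩

end IsUnitriangular

end Unitriangular

/-- A connection of a Lie-Rinehart algebra `g` over `A` on an `A`-module `M`: an additive operator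
`D X` for each `X : g`, `A`-linear in `X` and satisfying the Leibniz rule. -/
structure LRConnection (A g M : Type*) [CommRing A] [LieRing g] [Module A g] [LieRingModule g A]
    [AddCommGroup M] [Module A M] where
  /-- the covariant derivative -/
  toLinearMap : g →ₗ[A] M →+ M
  leibniz' (X : g) (a : A) (m : M) : toLinearMap X (a • m) = a • toLinearMap X m + ⁅X, a⁆ • m

theorem anchor_one {A g : Type*} [CommRing A] [LieRing g] [Module A g] [LieRingModule g A]
    [LieRinehartRing A g] (X : g) : ⁅X, (1 : A)⁆ = 0 := by
  simpa using LieRinehartRing.leibniz_mul_right X (1 : A) 1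

namespace LRConnection

noncomputable section

section Basic

variable {A g M : Type*} [CommRing A] [LieRing g] [Module A g] [LieRingModule g A]
  [AddCommGroup M] [Module A M]

instance : FunLike (LRConnection A g M) g (M →+ M) where
  coe D := D.toLinearMap
  coe_injective := fun ⟨_, _⟩ ⟨_, _⟩ h => by congr; exact DFunLike.coe_injective h

instance : LinearMapClass (LRConnection A g M) A g (M →+ M) where
  map_add D := D.toLinearMap.map_add
  map_smulₛₗ D := D.toLinearMap.map_smul

variable (D : LRConnection A g M)

theorem leibniz (X : g) (a : A) (m : M) : D X (a • m) = a • D X m + ⁅X, a⁆ • m :=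
  D.leibniz' X a m

theorem add_apply (X Y : g) (m : M) : D (X + Y) m = D X m + D Y m := by
  rw [map_add, AddMonoidHom.add_apply]

theorem smul_apply (a : A) (X : g) (m : M) : D (a • X) m = a • D X m := by
  rw [map_smul, AddMonoidHom.smul_apply]

theorem apply_mem_of_mem_span {X : g} {s : Set M} {N : Submodule A M}
    (h : ∀ m ∈ s, m ∈ N ∧ D X m ∈ N) {m : M} (hm : m ∈ Submodule.span A s) : D X m ∈ N := by
  have hN : Submodule.span A s ≤ N := Submodule.span_le.2 fun m hm => (h m hm).1
  induction hm using Submodule.span_induction with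
  | mem m hm => exact (h m hm).2
  | zero => rw [map_zero]; exact zero_mem N
  | add m m' _ _ hm hm' => rw [map_add]; exact add_mem hm hm'
  | smul a m hm h =>
    rw [leibniz]
    exact add_mem (N.smul_mem _ h) (N.smul_mem _ (hN hm))

/-- The connections on `M` form an affine space over the linear maps `g → End_A(M)`. -/
def addLinear (T : g →ₗ[A] M →ₗ[A] M) : LRConnection A g M where
  toLinearMap :=
    { toFun := fun X => D X + (T X).toAddMonoidHom
      map_add' := fun X Y => by
        ext m
        simp only [map_add, AddMonoidHom.add_apply, LinearMap.toAddMonoidHom_coe,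
          LinearMap.add_apply]
        abel
      map_smul' := fun a X => by ext m; simp }
  leibniz' X a m := by
    simp only [LinearMap.coe_mk, AddHom.coe_mk, AddMonoidHom.add_apply, leibniz,
      LinearMap.toAddMonoidHom_coe, map_smul, smul_add]
    abel

theorem addLinear_apply (T : g →ₗ[A] M →ₗ[A] M) (X : g) (m : M) :
    D.addLinear T X m = D X m + T X m := rfl

/-- The pullback of a connection along a linear map compatible with the anchors. -/
def comap {g' : Type*} [LieRing g'] [Module A g'] [LieRingModule g' A]
    (D : LRConnection A g M) (f : g' →ₗ[A] g) (hf : ∀ (X : g') (a : A), ⁅f X, a⁆ = ⁅X, a⁆) :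
    LRConnection A g' M where
  toLinearMap := D.toLinearMap ∘ₗ f
  leibniz' X a m := by rw [← hf]; exact D.leibniz (f X) a m

theorem comap_apply {g' : Type*} [LieRing g'] [Module A g'] [LieRingModule g' A]
    (D : LRConnection A g M) (f : g' →ₗ[A] g) (hf : ∀ (X : g') (a : A), ⁅f X, a⁆ = ⁅X, a⁆)
    (X : g') (m : M) : D.comap f hf X m = D (f X) m := rfl

end Basic

section Curvature

variable {A g M : Type*} [CommRing A] [LieRing g] [Module A g] [LieRingModule g A]
  [LieRinehartRing A g] [AddCommGroup M] [Module A M]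

/-- The curvature `[D X, D Y] - D [X, Y]`. -/
def curvature (D : LRConnection A g M) : g →ₗ[A] g →ₗ[A] M →ₗ[A] M :=
  LinearMap.mk₂ A
    (fun X Y =>
      { toFun := fun m => D X (D Y m) - D Y (D X m) - D ⁅X, Y⁆ m
        map_add' := fun m m' => by simp only [map_add]; abel
        map_smul' := fun a m => by
          simp only [leibniz, map_add, lie_lie, RingHom.id_apply, smul_sub, sub_smul]
          abel })
    (fun X X' Y => by
      ext m
      simp only [map_add, AddMonoidHom.add_apply, add_lie, LinearMap.coe_mk, AddHom.coe_mk,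
        LinearMap.add_apply]
      abel)
    (fun a X Y => by
      ext m
      have h : ⁅a • X, Y⁆ = a • ⁅X, Y⁆ - ⁅Y, a⁆ • X := by
        rw [← lie_skew, LieRinehartRing.leibniz_smul_right, ← lie_skew X Y]
        module
      simp only [h, map_sub, AddMonoidHom.sub_apply, smul_apply, leibniz, LinearMap.coe_mk,
        AddHom.coe_mk, LinearMap.smul_apply]
      module)
    (fun X Y Y' => by
      ext m
      simp only [map_add, AddMonoidHom.add_apply, lie_add, LinearMap.coe_mk, AddHom.coe_mk,
        LinearMap.add_apply]
      abel)
    (fun a X Y => by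
      ext m
      simp only [smul_apply, leibniz, LieRinehartRing.leibniz_smul_right, map_add,
        AddMonoidHom.add_apply, LinearMap.coe_mk, AddHom.coe_mk, LinearMap.smul_apply, smul_sub]
      abel)

theorem curvature_apply (D : LRConnection A g M) (X Y : g) (m : M) :
    D.curvature X Y m = D X (D Y m) - D Y (D X m) - D ⁅X, Y⁆ m := rfl

theorem curvature_self (D : LRConnection A g M) (X : g) : D.curvature X X = 0 := by
  ext m; simp [curvature_apply]

theorem curvature_swap (D : LRConnection A g M) (X Y : g) :
    D.curvature X Y = -D.curvature Y X := by
  ext m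
  simp only [curvature_apply, LinearMap.neg_apply, ← lie_skew X Y, map_neg,
    AddMonoidHom.neg_apply]
  abel

theorem bianchi (D : LRConnection A g M) (X Y Z : g) (m : M) :
    D X (D.curvature Y Z m) - D.curvature Y Z (D X m) + D.curvature X ⁅Y, Z⁆ m
      + (D Y (D.curvature Z X m) - D.curvature Z X (D Y m) + D.curvature Y ⁅Z, X⁆ m)
      + (D Z (D.curvature X Y m) - D.curvature X Y (D Z m) + D.curvature Z ⁅X, Y⁆ m) = 0 := by
  have h : D ⁅X, ⁅Y, Z⁆⁆ m + D ⁅Y, ⁅Z, X⁆⁆ m + D ⁅Z, ⁅X, Y⁆⁆ m = 0 := by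
    rw [← add_apply, ← add_apply, lie_jacobi, map_zero, AddMonoidHom.zero_apply]
  simp only [curvature_apply, map_sub]
  rw [← neg_eq_zero, ← h]
  abel

/-- A connection is flat if it is a representation of the Lie algebra `g`. -/
def IsFlat (D : LRConnection A g M) : Prop := D.curvature = 0

theorem IsFlat.lie_apply {D : LRConnection A g M} (h : D.IsFlat) (X Y : g) (m : M) :
    D ⁅X, Y⁆ m = D X (D Y m) - D Y (D X m) := by
  have hXY : D.curvature X Y m = 0 := by rw [h]; rfl
  rw [curvature_apply, sub_eq_zero] at hXY
  exact hXY.symm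

theorem IsFlat.comap {g' : Type*} [LieRing g'] [Module A g'] [LieRingModule g' A]
    [LieRinehartRing A g'] {D : LRConnection A g M} (hD : D.IsFlat) {f : g' →ₗ[A] g}
    (hf : ∀ (X : g') (a : A), ⁅f X, a⁆ = ⁅X, a⁆) (hlie : ∀ X Y, f ⁅X, Y⁆ = ⁅f X, f Y⁆) :
    (D.comap f hf).IsFlat := by
  ext X Y m
  simp [curvature_apply, comap_apply, hlie, hD.lie_apply]

/-- The flat connection for which the vectors of a basis are parallel. -/
def ofBasis {ι : Type*} (e : Module.Basis ι A M) : LRConnection A g M where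
  toLinearMap :=
    { toFun := fun X => (e.repr.symm.toLinearMap.toAddMonoidHom.comp
        (Finsupp.mapRange.addMonoidHom (LieRingModule.toEnd g A X))).comp
          e.repr.toLinearMap.toAddMonoidHom
      map_add' := fun X Y => by
        ext m
        refine e.repr.injective (Finsupp.ext fun i => ?_)
        simp
      map_smul' := fun a X => by
        ext m
        refine e.repr.injective (Finsupp.ext fun i => ?_)
        simp }
  leibniz' X a m := by
    refine e.repr.injective (Finsupp.ext fun i => ?_)
    simp

theorem repr_ofBasis_apply {ι : Type*} (e : Module.Basis ι A M) (X : g) (m : M) (i : ι) :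
    e.repr (ofBasis e X m) i = ⁅X, e.repr m i⁆ := by
  change e.repr (e.repr.symm (Finsupp.mapRange.addMonoidHom (LieRingModule.toEnd g A X)
    (e.repr m))) i = _
  rw [LinearEquiv.apply_symm_apply]
  rfl

theorem isFlat_ofBasis {ι : Type*} (e : Module.Basis ι A M) :
    (ofBasis e : LRConnection A g M).IsFlat := by
  refine LinearMap.ext₂ fun X Y => LinearMap.ext fun m => e.repr.injective (Finsupp.ext fun i => ?_)
  simp [curvature_apply, repr_ofBasis_apply]

theorem ofBasis_apply_basis {ι : Type*} (e : Module.Basis ι A M) (X : g) (i : ι) :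
    ofBasis e X (e i) = 0 := by
  classical
  refine e.repr.injective (Finsupp.ext fun j => ?_)
  rw [repr_ofBasis_apply, e.repr_self, Finsupp.single_apply, apply_ite (Bracket.bracket X),
    anchor_one, lie_zero, ite_self, map_zero, Finsupp.zero_apply]

end Curvature

section Lift

variable {k A g M : Type*} [CommRing k] [CommRing A] [Algebra k A] [LieRing g] [LieAlgebra k g]
  [Module A g] [LieRingModule g A] [LieRinehartRing A g] [LieRinehartAlgebra k A g]
  [AddCommGroup M] [Module A M] [Module k M] [IsScalarTower k A M]

theorem map_base_smul (D : LRConnection A g M) (X : g) (r : k) (m : M) :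
    D X (r • m) = r • D X m := by
  rw [← algebraMap_smul A r m, leibniz, Algebra.algebraMap_eq_smul_one, lie_smul r X, anchor_one,
    smul_zero, zero_smul, add_zero, smul_one_smul]

open LRUniversalEnveloping

/-- The action of the universal enveloping algebra given by a flat connection. -/
def IsFlat.action {D : LRConnection A g M} (h : D.IsFlat) :
    LRUniversalEnveloping k A g →ₐ[k] Module.End k M :=
  lift (Algebra.lsmul k k M)
    { toFun := fun X => { D X with map_smul' := D.map_base_smul X }
      map_add' := fun X Y => by ext m; simp
      map_smul' := fun r X => by
        ext m
        change D (r • X) m = r • D X m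
        rw [← algebraMap_smul A r X, smul_apply, algebraMap_smul] }
    (fun X Y => by ext m; simp [h.lie_apply])
    (fun a X => by ext m; simp)
    (fun X a => by ext m; simp [leibniz])

theorem IsFlat.action_base_smul {D : LRConnection A g M} (h : D.IsFlat) (a : A)
    (u : LRUniversalEnveloping k A g) (m : M) : h.action (a • u) m = a • h.action u m := by
  rw [base_smul_def, map_mul, Module.End.mul_apply, action, lift_ofBase]
  rfl

theorem IsFlat.action_lie_mul {D : LRConnection A g M} (h : D.IsFlat) (X : g)
    (u : LRUniversalEnveloping k A g) (m : M) :
    h.action (ofLie k A g X * u) m = D X (h.action u m) := by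
  rw [map_mul, Module.End.mul_apply, action, lift_ofLie]
  rfl

end Lift

end

end LRConnection

/-- The semidirect product of a Lie-Rinehart algebra `g` and a module with a flat connection `D`,
seen as an abelian Lie algebra. It acts on the base through `g`. -/
@[ext]
structure LRSemidirect {A g M : Type*} [CommRing A] [LieRing g] [Module A g] [LieRingModule g A]
    [LieRinehartRing A g] [AddCommGroup M] [Module A M] {D : LRConnection A g M}
    (hD : D.IsFlat) where
  /-- the component in `g` -/
  fst : g
  /-- the component in the module -/
  snd : M

namespace LRSemidirect

noncomputable section

variable {A g M : Type*} [CommRing A] [LieRing g] [Module A g] [LieRingModule g A]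
  [LieRinehartRing A g] [AddCommGroup M] [Module A M] {D : LRConnection A g M} {hD : D.IsFlat}

variable (hD) in
/-- The underlying pair. -/
def equivProd : LRSemidirect hD ≃ g × M where
  toFun x := (x.fst, x.snd)
  invFun x := ⟨x.1, x.2⟩

instance : AddCommGroup (LRSemidirect hD) := (equivProd hD).addCommGroup

instance {R : Type*} [Semiring R] [Module R g] [Module R M] : Module R (LRSemidirect hD) :=
  (equivProd hD).module R

variable (hD) in
/-- The underlying module is the product. -/
def linearEquivProd : LRSemidirect hD ≃ₗ[A] g × M := (equivProd hD).linearEquiv A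

@[simp] theorem fst_zero : (0 : LRSemidirect hD).fst = 0 := rfl
@[simp] theorem snd_zero : (0 : LRSemidirect hD).snd = 0 := rfl
@[simp] theorem fst_add (x y : LRSemidirect hD) : (x + y).fst = x.fst + y.fst := rfl
@[simp] theorem snd_add (x y : LRSemidirect hD) : (x + y).snd = x.snd + y.snd := rfl

section SMul

variable {R : Type*} [Semiring R] [Module R g] [Module R M]

@[simp] theorem fst_smul (r : R) (x : LRSemidirect hD) : (r • x).fst = r • x.fst := rfl
@[simp] theorem snd_smul (r : R) (x : LRSemidirect hD) : (r • x).snd = r • x.snd := rfl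

end SMul

instance : Bracket (LRSemidirect hD) (LRSemidirect hD) where
  bracket x y := ⟨⁅x.fst, y.fst⁆, D x.fst y.snd - D y.fst x.snd⟩

@[simp] theorem fst_lie (x y : LRSemidirect hD) : ⁅x, y⁆.fst = ⁅x.fst, y.fst⁆ := rfl

@[simp]
theorem snd_lie (x y : LRSemidirect hD) : ⁅x, y⁆.snd = D x.fst y.snd - D y.fst x.snd := rfl

instance : LieRing (LRSemidirect hD) where
  add_lie x y z := by
    ext
    · simp only [fst_lie, fst_add, add_lie]
    · simp only [snd_lie, fst_add, map_add, AddMonoidHom.add_apply, snd_add]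
      abel
  lie_add x y z := by
    ext
    · simp only [fst_lie, fst_add, lie_add]
    · simp only [snd_lie, fst_add, map_add, AddMonoidHom.add_apply, snd_add]
      abel
  lie_self x := by ext <;> simp
  leibniz_lie x y z := by
    ext
    · simp
    · simp only [snd_lie, fst_lie, snd_add, map_sub, hD.lie_apply]
      abel

instance : LieRingModule (LRSemidirect hD) A where
  bracket x a := ⁅x.fst, a⁆
  add_lie x y a := add_lie x.fst y.fst a
  lie_add x a b := lie_add x.fst a b
  leibniz_lie x y a := leibniz_lie x.fst y.fst a

theorem lie_base (x : LRSemidirect hD) (a : A) : ⁅x, a⁆ = ⁅x.fst, a⁆ := rfl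

instance : LieRinehartRing A (LRSemidirect hD) where
  lie_smul_eq_mul' a b x := LieRinehartRing.lie_smul_eq_mul a b x.fst
  leibniz_mul_right' x a b := LieRinehartRing.leibniz_mul_right x.fst a b
  leibniz_smul_right' x y a := by
    ext
    · simp [lie_base]
    · simp only [snd_lie, fst_smul, snd_smul, snd_add, lie_base, D.leibniz, D.smul_apply]
      module

variable (hD) in
/-- The inclusion of `g`. -/
def inl : g →ₗ[A] LRSemidirect hD := (linearEquivProd hD).symm ∘ₗ LinearMap.inl A g M

theorem fst_inl (X : g) : (inl hD X).fst = X := rfl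

theorem inl_lie (X Y : g) : inl hD ⁅X, Y⁆ = ⁅inl hD X, inl hD Y⁆ := by
  change (⟨⁅X, Y⁆, 0⟩ : LRSemidirect hD) = ⟨⁅X, Y⁆, D X 0 - D Y 0⟩
  simp only [map_zero, sub_zero]

end

end LRSemidirect

noncomputable section PBW

open MvPolynomial

variable {A L J : Type*} [CommRing A] [LieRing L] [Module A L] [LieRingModule L A]
  [LieRinehartRing A L] [LinearOrder J] (b : Module.Basis J A L)

theorem degree_sub_single_lt {J : Type*} {m : J →₀ ℕ} {j : J} (h : j ∈ m.support) :
    (m - Finsupp.single j 1).degree < m.degree := by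
  conv_rhs => rw [← Finsupp.sub_add_single_one_cancel (Finsupp.mem_support_iff.1 h)]
  simp

/-- The lower order part of the action of the `i`-th basis vector of `L` on the monomial `x ^ m`:
this action is `x_i x ^ m + pbwCorrection b i m`. If `j < i` is the least letter of `m`, so that
`x ^ m = x_j x ^ t` is the action of the `j`-th basis vector on `x ^ t`, the value is forced by
`b_i b_j = b_j b_i + ⁅b_i, b_j⁆`. The condition on `s.degree` only serves termination. -/
def pbwCorrection (i : J) (m : J →₀ ℕ) : MvPolynomial J A :=
  if h : ∃ j ∈ m.support, j < i then
    let j := m.support.min' (h.imp fun _ hj => hj.1)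
    let t : J →₀ ℕ := m - Finsupp.single j 1
    have ht : t.degree < m.degree := degree_sub_single_lt (m.support.min'_mem _)
    X j * pbwCorrection i t + LRConnection.ofBasis (basisMonomials J A) (b j) (pbwCorrection i t)
      + (basisMonomials J A).constr A
        (fun s => if _ : s.degree < m.degree then pbwCorrection j s else 0) (pbwCorrection i t)
      + b.constr A X ⁅b i, b j⁆ * monomial t 1
      + b.constr A (fun l => pbwCorrection l t) ⁅b i, b j⁆
  else 0
termination_by m.degree

theorem pbwCorrection_of_le {i : J} {m : J →₀ ℕ} (h : ∀ l ∈ m.support, i ≤ l) :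
    pbwCorrection b i m = 0 := by
  rw [pbwCorrection.eq_def, dif_neg]
  push Not
  exact h

theorem forall_mem_support_add_single {J : Type*} {p : J → Prop} {t : J →₀ ℕ} {i : J} :
    (∀ l ∈ (t + Finsupp.single i 1).support, p l) ↔ p i ∧ ∀ l ∈ t.support, p l := by
  classical
  simp only [Finsupp.support_add_eq_union, Finsupp.support_single _ one_ne_zero,
    Finset.mem_union, Finset.mem_singleton, or_imp, forall_and, forall_eq, and_comm]

theorem pbwCorrection_add_single_aux {i j : J} {t : J →₀ ℕ} (hji : j < i)
    (hj : ∀ l ∈ t.support, j ≤ l) :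
    pbwCorrection b i (t + Finsupp.single j 1) =
      X j * pbwCorrection b i t
      + LRConnection.ofBasis (basisMonomials J A) (b j) (pbwCorrection b i t)
      + (basisMonomials J A).constr A
        (fun s => if s.degree ≤ t.degree then pbwCorrection b j s else 0) (pbwCorrection b i t)
      + b.constr A X ⁅b i, b j⁆ * monomial t 1
      + b.constr A (fun l => pbwCorrection b l t) ⁅b i, b j⁆ := by
  have hmem : j ∈ (t + Finsupp.single j 1).support := by simp
  have h : ∃ l ∈ (t + Finsupp.single j 1).support, l < i := ⟨j, hmem, hji⟩
  have hmin : (t + Finsupp.single j 1).support.min' ⟨j, hmem⟩ = j :=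
    le_antisymm (Finset.min'_le _ _ hmem)
      (Finset.le_min' _ _ _ (forall_mem_support_add_single.2 ⟨le_rfl, hj⟩))
  rw [pbwCorrection.eq_def, dif_pos h]
  simp only [hmin, add_tsub_cancel_right, map_add, Finsupp.degree_single, Nat.lt_succ_iff,
    dite_eq_ite]

section TotalDegree

variable {J : Type*} {f : MvPolynomial J A} {m : J →₀ ℕ} {n : ℕ}

variable (A J) in
/-- The polynomials of total degree less than `n`. -/
def totalDegreeLT (n : ℕ) : Submodule A (MvPolynomial J A) :=
  spanBelow A Finsupp.degree (fun m => monomial m 1) n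

theorem totalDegreeLT_mono : Monotone (totalDegreeLT A J) := spanBelow_mono

theorem monomial_mem_totalDegreeLT (h : m.degree < n) : monomial m 1 ∈ totalDegreeLT A J n :=
  apply_mem_spanBelow h

theorem totalDegreeLT_le {N : Submodule A (MvPolynomial J A)} :
    totalDegreeLT A J n ≤ N ↔ ∀ m : J →₀ ℕ, m.degree < n → monomial m 1 ∈ N :=
  spanBelow_le

theorem mul_mem_totalDegreeLT {p : MvPolynomial J A} (hp : p ∈ totalDegreeLT A J 2)
    (hf : f ∈ totalDegreeLT A J n) : p * f ∈ totalDegreeLT A J (n + 1) := by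
  suffices totalDegreeLT A J 2 * totalDegreeLT A J n ≤ totalDegreeLT A J (n + 1) from
    this (Submodule.mul_mem_mul hp hf)
  simp only [totalDegreeLT, spanBelow, Submodule.span_mul_span, Submodule.span_le]
  rintro _ ⟨_, ⟨s, hs, rfl⟩, _, ⟨t, ht, rfl⟩, rfl⟩
  simp only [Set.mem_ofPred_eq] at hs ht
  simp only [monomial_mul, one_mul]
  exact monomial_mem_totalDegreeLT (by rw [map_add]; omega)

theorem X_mem_totalDegreeLT (j : J) : X j ∈ totalDegreeLT A J 2 :=
  monomial_mem_totalDegreeLT (by simp)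

theorem constr_basisMonomials_monomial {M : Type*} [AddCommGroup M] [Module A M]
    (v : (J →₀ ℕ) → M) (m : J →₀ ℕ) : (basisMonomials J A).constr A v (monomial m 1) = v m :=
  (basisMonomials J A).constr_basis A v m

theorem ofBasis_monomial (Y : L) (m : J →₀ ℕ) :
    LRConnection.ofBasis (basisMonomials J A) Y (monomial m 1) = 0 :=
  LRConnection.ofBasis_apply_basis (basisMonomials J A) Y m

theorem ofBasis_mem_totalDegreeLT (Y : L) (hf : f ∈ totalDegreeLT A J n) :
    LRConnection.ofBasis (basisMonomials J A) Y f ∈ totalDegreeLT A J n := by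
  refine LRConnection.apply_mem_of_mem_span _ ?_ hf
  rintro _ ⟨m, hm, rfl⟩
  refine ⟨monomial_mem_totalDegreeLT hm, ?_⟩
  rw [ofBasis_monomial]
  exact zero_mem _

theorem constr_apply_mem {M : Type*} [AddCommGroup M] [Module A M] {N : Submodule A M}
    {ι V : Type*} [AddCommGroup V] [Module A V] (e : Module.Basis ι A V) {v : ι → M}
    (h : ∀ i, v i ∈ N) (x : V) : e.constr A v x ∈ N := by
  suffices LinearMap.range (e.constr A v) ≤ N from this ⟨x, rfl⟩
  rw [Module.Basis.constr_range, Submodule.span_le]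
  exact Set.range_subset_iff.2 h

theorem constr_X_mem_totalDegreeLT {V : Type*} [AddCommGroup V] [Module A V]
    (e : Module.Basis J A V) (x : V) : e.constr A X x ∈ totalDegreeLT A J 2 :=
  constr_apply_mem e X_mem_totalDegreeLT x

end TotalDegree

theorem exists_eq_add_single_le {m : J →₀ ℕ} (hm : m ≠ 0) :
    ∃ (t : J →₀ ℕ) (j : J), m = t + Finsupp.single j 1 ∧ ∀ l ∈ t.support, j ≤ l := by
  have hne := Finsupp.support_nonempty_iff.2 hm
  refine ⟨m - Finsupp.single (m.support.min' hne) 1, m.support.min' hne,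
    (Finsupp.sub_add_single_one_cancel
      (Finsupp.mem_support_iff.1 (m.support.min'_mem hne))).symm,
    fun l hl => m.support.min'_le l (Finsupp.support_tsub hl)⟩

theorem pbwCorrection_mem_totalDegreeLT (i : J) (m : J →₀ ℕ) :
    pbwCorrection b i m ∈ totalDegreeLT A J (m.degree + 1) := by
  induction hn : m.degree using Nat.strong_induction_on generalizing i m with
  | _ n ih =>
  by_cases h : ∀ l ∈ m.support, i ≤ l
  · rw [pbwCorrection_of_le b h]
    exact zero_mem _
  obtain ⟨t, j, rfl, hj⟩ := exists_eq_add_single_le (m := m) (by rintro rfl; simp at h)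
  have hji : j < i := lt_of_not_ge fun hij =>
    h (forall_mem_support_add_single.2 ⟨hij, fun l hl => hij.trans (hj l hl)⟩)
  have ht : t.degree + 1 = n := by simpa using hn
  have hlow : ∀ i s, s.degree ≤ t.degree → pbwCorrection b i s ∈ totalDegreeLT A J n :=
    fun i s hs => totalDegreeLT_mono (by omega) (ih _ (by omega) i s rfl)
  rw [pbwCorrection_add_single_aux b hji hj]
  have hit := hlow i t le_rfl
  have hmono := totalDegreeLT_mono (A := A) (J := J) (Nat.le_add_right n 1)
  refine add_mem (add_mem (add_mem (add_mem
    (mul_mem_totalDegreeLT (X_mem_totalDegreeLT j) hit)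
    (ofBasis_mem_totalDegreeLT _ (hmono hit))) (constr_apply_mem _ (fun s => ?_) _))
    (mul_mem_totalDegreeLT (constr_X_mem_totalDegreeLT b _)
      (monomial_mem_totalDegreeLT (by omega))))
    (constr_apply_mem _ (fun l => hmono (hlow l t le_rfl)) _)
  split_ifs with hs
  exacts [hmono (hlow j s hs), zero_mem _]

/-- The `A`-linear extension of `pbwCorrection` in both arguments. -/
def pbwCorrectionLinear : L →ₗ[A] MvPolynomial J A →ₗ[A] MvPolynomial J A :=
  b.constr A fun i => (basisMonomials J A).constr A (pbwCorrection b i)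

theorem pbwCorrectionLinear_basis (i : J) :
    pbwCorrectionLinear b (b i) = (basisMonomials J A).constr A (pbwCorrection b i) :=
  b.constr_basis A _ i

theorem pbwCorrectionLinear_monomial (Y : L) (m : J →₀ ℕ) :
    pbwCorrectionLinear b Y (monomial m 1) = b.constr A (fun i => pbwCorrection b i m) Y := by
  suffices (pbwCorrectionLinear b).flip (monomial m 1) =
      b.constr A (fun i => pbwCorrection b i m) from LinearMap.congr_fun this Y
  refine b.ext fun i => ?_
  rw [LinearMap.flip_apply, pbwCorrectionLinear_basis, Module.Basis.constr_basis,
    constr_basisMonomials_monomial]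

theorem pbwCorrectionLinear_mem_totalDegreeLT (Y : L) {f : MvPolynomial J A} {n : ℕ}
    (hf : f ∈ totalDegreeLT A J n) : pbwCorrectionLinear b Y f ∈ totalDegreeLT A J n := by
  suffices totalDegreeLT A J n ≤ (totalDegreeLT A J n).comap (pbwCorrectionLinear b Y) from this hf
  refine totalDegreeLT_le.2 fun m hm => ?_
  rw [Submodule.mem_comap, pbwCorrectionLinear_monomial]
  exact constr_apply_mem _
    (fun i => totalDegreeLT_mono hm (pbwCorrection_mem_totalDegreeLT b i m)) _

theorem pbwCorrection_add_single {i j : J} {t : J →₀ ℕ} (hji : j < i)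
    (hj : ∀ l ∈ t.support, j ≤ l) :
    pbwCorrection b i (t + Finsupp.single j 1) =
      X j * pbwCorrection b i t
      + LRConnection.ofBasis (basisMonomials J A) (b j) (pbwCorrection b i t)
      + pbwCorrectionLinear b (b j) (pbwCorrection b i t)
      + b.constr A X ⁅b i, b j⁆ * monomial t 1
      + pbwCorrectionLinear b ⁅b i, b j⁆ (monomial t 1) := by
  have hguard : Set.EqOn ((basisMonomials J A).constr A
        (fun s => if s.degree ≤ t.degree then pbwCorrection b j s else 0))
      (pbwCorrectionLinear b (b j)) (totalDegreeLT A J (t.degree + 1)) := by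
    refine LinearMap.eqOn_span' ?_
    rintro _ ⟨s, hs, rfl⟩
    rw [pbwCorrectionLinear_basis, constr_basisMonomials_monomial,
      constr_basisMonomials_monomial, if_pos (Nat.lt_succ_iff.1 hs)]
  rw [pbwCorrection_add_single_aux b hji hj, hguard (pbwCorrection_mem_totalDegreeLT b i t),
    pbwCorrectionLinear_monomial]

/-- The connection on the polynomial ring `A[J]` for which the `i`-th basis vector of `L` acts on
monomials as multiplication by `x_i`, corrected by terms of lower order. -/
def pbwConnection : LRConnection A L (MvPolynomial J A) :=
  (LRConnection.ofBasis (basisMonomials J A)).addLinear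
    (LinearMap.mul A (MvPolynomial J A) ∘ₗ b.constr A X + pbwCorrectionLinear b)

theorem pbwConnection_apply (Y : L) (f : MvPolynomial J A) :
    pbwConnection b Y f = b.constr A X Y * f
      + (LRConnection.ofBasis (basisMonomials J A) Y f + pbwCorrectionLinear b Y f) := by
  simp only [pbwConnection, LRConnection.addLinear_apply, LinearMap.add_apply,
    LinearMap.comp_apply, LinearMap.mul_apply']
  abel

theorem pbwConnection_sub_mem_totalDegreeLT (Y : L) {f : MvPolynomial J A} {n : ℕ}
    (hf : f ∈ totalDegreeLT A J n) :
    pbwConnection b Y f - b.constr A X Y * f ∈ totalDegreeLT A J n := by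
  rw [pbwConnection_apply, add_sub_cancel_left]
  exact add_mem (ofBasis_mem_totalDegreeLT Y hf) (pbwCorrectionLinear_mem_totalDegreeLT b Y hf)

theorem pbwConnection_monomial (Y : L) (t : J →₀ ℕ) :
    pbwConnection b Y (monomial t 1) =
      b.constr A X Y * monomial t 1 + pbwCorrectionLinear b Y (monomial t 1) := by
  rw [pbwConnection_apply, ofBasis_monomial, zero_add]

theorem pbwConnection_basis_monomial (i : J) (t : J →₀ ℕ) :
    pbwConnection b (b i) (monomial t 1) =
      monomial (t + Finsupp.single i 1) 1 + pbwCorrection b i t := by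
  rw [pbwConnection_monomial, pbwCorrectionLinear_monomial, Module.Basis.constr_basis,
    Module.Basis.constr_basis, X, monomial_mul, one_mul,
    add_comm (Finsupp.single i 1)]

theorem pbwConnection_basis_monomial_of_le {j : J} {t : J →₀ ℕ} (h : ∀ l ∈ t.support, j ≤ l) :
    pbwConnection b (b j) (monomial t 1) = monomial (t + Finsupp.single j 1) 1 := by
  rw [pbwConnection_basis_monomial, pbwCorrection_of_le b h, add_zero]

theorem curvature_monomial_of_lt {i j : J} {t : J →₀ ℕ} (hji : j < i)
    (hj : ∀ l ∈ t.support, j ≤ l) :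
    (pbwConnection b).curvature (b i) (b j) (monomial t 1) = 0 := by
  have hji' : ∀ l ∈ (t + Finsupp.single i 1).support, j ≤ l :=
    forall_mem_support_add_single.2 ⟨hji.le, hj⟩
  rw [LRConnection.curvature_apply, pbwConnection_basis_monomial_of_le b hj,
    pbwConnection_basis_monomial, pbwConnection_basis_monomial b i t, map_add,
    pbwConnection_basis_monomial_of_le b hji', pbwCorrection_add_single b hji hj,
    pbwConnection_apply b (b j), pbwConnection_monomial, Module.Basis.constr_basis,
    add_right_comm t]
  abel

theorem curvature_monomial_of_le (i : J) {j : J} {t : J →₀ ℕ} (hj : ∀ l ∈ t.support, j ≤ l) :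
    (pbwConnection b).curvature (b i) (b j) (monomial t 1) = 0 := by
  rcases lt_trichotomy i j with hij | rfl | hji
  · rw [LRConnection.curvature_swap, LinearMap.neg_apply,
      curvature_monomial_of_lt b hij fun l hl => hij.le.trans (hj l hl), neg_zero]
  · rw [LRConnection.curvature_self, LinearMap.zero_apply]
  · exact curvature_monomial_of_lt b hji hj

theorem curvature_apply_eq_zero_of_basis {J M : Type*} (b : Module.Basis J A L) [AddCommGroup M]
    [Module A M] {D : LRConnection A L M} {m : M} (h : ∀ i j, D.curvature (b i) (b j) m = 0)
    (Y Z : L) : D.curvature Y Z m = 0 := by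
  suffices D.curvature.compr₂ (LinearMap.applyₗ m) = 0 from LinearMap.congr_fun₂ this Y Z
  exact LinearMap.ext_basis b b h

theorem curvature_monomial_add_single {n : ℕ}
    (ih : ∀ Y Z, ∀ f ∈ totalDegreeLT A J n, (pbwConnection b).curvature Y Z f = 0)
    {t : J →₀ ℕ} (ht : t.degree < n) {j : J} (hj : ∀ l ∈ t.support, j ≤ l) (i i' : J) :
    (pbwConnection b).curvature (b i) (b i') (monomial (t + Finsupp.single j 1) 1) = 0 := by
  rcases le_or_gt i' j with hi' | hi'
  · exact curvature_monomial_of_le b i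
      (forall_mem_support_add_single.2 ⟨hi', fun l hl => hi'.trans (hj l hl)⟩)
  rcases le_or_gt i j with hi | hi
  · rw [LRConnection.curvature_swap, LinearMap.neg_apply, curvature_monomial_of_le b i'
      (forall_mem_support_add_single.2 ⟨hi, fun l hl => hi.trans (hj l hl)⟩), neg_zero]
  have hzero : ∀ l l', j < l →
      (pbwConnection b).curvature (b l') (b j) (pbwConnection b (b l) (monomial t 1)) = 0 := by
    intro l l' hl
    rw [pbwConnection_basis_monomial, map_add, curvature_monomial_of_le b l'
      (forall_mem_support_add_single.2 ⟨hl.le, hj⟩), zero_add]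
    exact ih _ _ _ (totalDegreeLT_mono ht (pbwCorrection_mem_totalDegreeLT b l t))
  have hbianchi := (pbwConnection b).bianchi (b j) (b i) (b i') (monomial t 1)
  have ht' : ∀ Y Z, (pbwConnection b).curvature Y Z (monomial t 1) = 0 :=
    fun Y Z => ih Y Z _ (monomial_mem_totalDegreeLT ht)
  rw [LRConnection.curvature_swap _ (b j) (b i), LinearMap.neg_apply, hzero i i' hi,
    LinearMap.neg_apply, hzero i' i hi', pbwConnection_basis_monomial_of_le b hj] at hbianchi
  simpa [ht'] using hbianchi

/-- A nonconstant monomial is the image of a smaller one under the action of its least letter, so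
that the Bianchi identity propagates flatness upwards in the degree. -/
theorem isFlat_pbwConnection : (pbwConnection b).IsFlat := by
  have h : ∀ n Y Z, ∀ f ∈ totalDegreeLT A J n, (pbwConnection b).curvature Y Z f = 0 := by
    intro n
    induction n with
    | zero =>
      intro Y Z f hf
      rw [totalDegreeLT, spanBelow_zero, Submodule.mem_bot] at hf
      rw [hf, map_zero]
    | succ n ih =>
      intro Y Z
      suffices totalDegreeLT A J (n + 1) ≤ LinearMap.ker ((pbwConnection b).curvature Y Z) from this
      refine totalDegreeLT_le.2 fun m hm => curvature_apply_eq_zero_of_basis b (fun i i' => ?_) Y Z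
      rcases eq_or_ne m 0 with rfl | hm0
      · exact curvature_monomial_of_le b i (by simp)
      obtain ⟨t, j, rfl, hj⟩ := exists_eq_add_single_le hm0
      exact curvature_monomial_add_single b ih (by simpa using hm) hj i i'
  refine LinearMap.ext₂ fun Y Z => (basisMonomials J A).ext fun m => ?_
  exact h (m.degree + 1) Y Z _ (apply_mem_spanBelow m.degree.lt_succ_self)

end PBW

section Words

variable {X M N : Type*} [Monoid M] [Monoid N]

/-- The product in `M` of a word in the letters `X`. -/
def wordProd (f : X → M) (l : List X) : M := (l.map f).prod

theorem wordProd_nil (f : X → M) : wordProd f [] = 1 := rfl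

theorem wordProd_cons (f : X → M) (x : X) (l : List X) :
    wordProd f (x :: l) = f x * wordProd f l := by
  rw [wordProd, List.map_cons, List.prod_cons, wordProd]

theorem map_wordProd {F : Type*} [FunLike F M N] [MonoidHomClass F M N] (φ : F) (f : X → M)
    (l : List X) : φ (wordProd f l) = wordProd (fun x => φ (f x)) l := by
  rw [wordProd, map_list_prod, List.map_map]
  rfl

variable {A : Type*} [CommRing A]

theorem wordProd_mem_totalDegreeLT {J : Type*} {f : X → MvPolynomial J A}
    (hf : ∀ x, f x ∈ totalDegreeLT A J 2) (l : List X) :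
    wordProd f l ∈ totalDegreeLT A J (l.length + 1) := by
  induction l with
  | nil => exact monomial_mem_totalDegreeLT (by simp)
  | cons x l ih => exact mul_mem_totalDegreeLT (hf x) ih

theorem exists_wordProd_X_eq_monomial (A : Type*) {J : Type*} [CommRing A] (m : J →₀ ℕ) :
    ∃ l : List J, l.length = m.degree ∧
      wordProd MvPolynomial.X l = MvPolynomial.monomial m (1 : A) := by
  refine ⟨m.toMultiset.toList, by rw [Multiset.length_toList, Finsupp.card_toMultiset]; rfl, ?_⟩
  rw [wordProd, ← Multiset.prod_coe, ← Multiset.map_coe, Multiset.coe_toList,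
    Finsupp.toMultiset_map, Finsupp.prod_toMultiset, MvPolynomial.monomial_eq, map_one, one_mul]
  exact Finsupp.prod_mapDomain_index (fun _ => pow_zero _) (fun _ _ _ => pow_add _ _ _)

theorem totalDegreeLT_le_spanBelow_wordProd (A J : Type*) [CommRing A] (n : ℕ) :
    totalDegreeLT A J n ≤
      spanBelow A List.length (wordProd (MvPolynomial.X : J → MvPolynomial J A)) n := by
  refine totalDegreeLT_le.2 fun m hm => ?_
  obtain ⟨l, hl, hlm⟩ := exists_wordProd_X_eq_monomial A m
  rw [← hlm]
  exact apply_mem_spanBelow (by rwa [hl])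

theorem span_range_wordProd_ι (A g : Type*) [CommRing A] [AddCommGroup g] [Module A g] :
    Submodule.span A (Set.range (wordProd (SymmetricAlgebra.ι A g))) = ⊤ := by
  set S := Submodule.span A (Set.range (wordProd (SymmetricAlgebra.ι A g)))
  have hone : 1 ∈ S := Submodule.subset_span ⟨[], rfl⟩
  have hmul : S * S ≤ S := by
    rw [Submodule.span_mul_span, Submodule.span_le]
    rintro _ ⟨_, ⟨l, rfl⟩, _, ⟨l', rfl⟩, rfl⟩
    exact Submodule.subset_span ⟨l ++ l', by simp only [wordProd, List.map_append,
      List.prod_append]⟩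
  refine eq_top_iff.2 fun x _ => ?_
  induction x using SymmetricAlgebra.induction with
  | algebraMap a => rw [Algebra.algebraMap_eq_smul_one]; exact S.smul_mem a hone
  | ι X => exact Submodule.subset_span ⟨[X], by rw [wordProd_cons, wordProd_nil, mul_one]⟩
  | mul x y hx hy => exact hmul (Submodule.mul_mem_mul (hx trivial) (hy trivial))
  | add x y hx hy => exact add_mem (hx trivial) (hy trivial)

end Words

noncomputable section EnvelopingWords

open LRUniversalEnveloping

variable {k A g : Type*} [CommRing k] [CommRing A] [Algebra k A] [LieRing g] [LieAlgebra k g]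
  [Module A g] [LieRingModule g A]

variable (k A g) in
/-- The action of `g` on its enveloping algebra by left multiplication. -/
def mulConnection : LRConnection A g (LRUniversalEnveloping k A g) where
  toLinearMap :=
    { toFun := fun X => AddMonoidHom.mulLeft (ofLie k A g X)
      map_add' := fun X Y => by ext u; simp [add_mul]
      map_smul' := fun a X => by ext u; simp [ofLie_smul, base_smul_def, mul_assoc] }
  leibniz' X a u := by
    simp [base_smul_def, ← mul_assoc, ofLie_mul_ofBase, add_mul]

theorem mulConnection_apply (X : g) (u : LRUniversalEnveloping k A g) :
    mulConnection k A g X u = ofLie k A g X * u := rfl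

theorem ofLie_mul_mem_spanBelow_wordProd (X : g) {u : LRUniversalEnveloping k A g} {n : ℕ}
    (hu : u ∈ spanBelow A List.length (wordProd (ofLie k A g)) n) :
    ofLie k A g X * u ∈ spanBelow A List.length (wordProd (ofLie k A g)) (n + 1) := by
  refine (mulConnection k A g).apply_mem_of_mem_span ?_ hu
  rintro _ ⟨l, hl, rfl⟩
  rw [Set.mem_ofPred_eq] at hl
  rw [mulConnection_apply, ← wordProd_cons]
  exact ⟨apply_mem_spanBelow (hl.trans n.lt_succ_self), apply_mem_spanBelow (by simpa using hl)⟩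

theorem span_range_wordProd_ofLie :
    Submodule.span A (Set.range (wordProd (ofLie k A g))) = ⊤ := by
  refine eq_top_iff.2 fun u _ => ?_
  induction u using LRUniversalEnveloping.induction with
  | one => exact Submodule.subset_span ⟨[], rfl⟩
  | add u v hu hv => exact add_mem (hu trivial) (hv trivial)
  | smul a u hu => exact Submodule.smul_mem _ a (hu trivial)
  | lie X u hu =>
    refine (mulConnection k A g).apply_mem_of_mem_span ?_ (hu trivial)
    rintro _ ⟨l, rfl⟩
    exact ⟨Submodule.subset_span ⟨l, rfl⟩, Submodule.subset_span ⟨X :: l, wordProd_cons _ X l⟩⟩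

theorem wordProd_sub_wordProd_mem_of_perm {l l' : List g} (h : l.Perm l') :
    wordProd (ofLie k A g) l - wordProd (ofLie k A g) l' ∈
      spanBelow A List.length (wordProd (ofLie k A g)) l.length := by
  induction h with
  | nil => rw [sub_self]; exact zero_mem _
  | cons X _ ih =>
    rw [wordProd_cons, wordProd_cons, ← mul_sub]
    exact ofLie_mul_mem_spanBelow_wordProd X ih
  | swap X Y l =>
    have h : wordProd (ofLie k A g) (Y :: X :: l) - wordProd (ofLie k A g) (X :: Y :: l) =
        wordProd (ofLie k A g) (⁅Y, X⁆ :: l) := by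
      simp only [wordProd_cons, ofLie_lie, sub_mul, mul_assoc]
    rw [h]
    exact apply_mem_spanBelow (by simp)
  | trans h _ ih ih' =>
    rw [← h.length_eq] at ih'
    rw [← sub_add_sub_cancel]
    exact add_mem ih ih'

end EnvelopingWords

noncomputable section Symbol

open LRUniversalEnveloping

section Swindle

variable {A P F : Type*} [CommRing A] [AddCommGroup P] [Module A P] [AddCommGroup F] [Module A F]

/-- The Eilenberg swindle: a direct summand `P` of `F` is absorbed by a countable sum of copies
of `F`. -/
def eilenbergSwindle {s : P →ₗ[A] F} {π : F →ₗ[A] P} (h : ∀ x, π (s x) = x) :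
    (P × (ℕ →₀ F)) ≃ₗ[A] (ℕ →₀ F) :=
  LinearEquiv.ofLinearMap
    (LinearMap.coprod (Finsupp.lsingle 0 ∘ₗ s)
      (Finsupp.lmapDomain F A Nat.succ ∘ₗ Finsupp.mapRange.linearMap (s ∘ₗ π)
        + Finsupp.mapRange.linearMap (LinearMap.id - s ∘ₗ π)))
    (LinearMap.prod (π ∘ₗ Finsupp.lapply 0)
      (Finsupp.lcomapDomain Nat.succ Nat.succ_injective ∘ₗ Finsupp.mapRange.linearMap (s ∘ₗ π)
        + Finsupp.mapRange.linearMap (LinearMap.id - s ∘ₗ π)))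
    (by
      refine LinearMap.ext fun f => Finsupp.ext fun n => ?_
      cases n with
      | zero => simp [h, Finsupp.mapDomain_of_notMem_range]
      | succ n => simp [h, Finsupp.mapDomain_apply Nat.succ_injective])
    (by
      refine LinearMap.ext fun f => Prod.ext ?_ (Finsupp.ext fun n => ?_)
      · simp [h, Finsupp.mapDomain_of_notMem_range]
      · cases n with
        | zero =>
          simp [h, Finsupp.mapDomain_apply Nat.succ_injective, Finsupp.mapDomain_of_notMem_range]
        | succ n => simp [h, Finsupp.mapDomain_apply Nat.succ_injective])

end Swindle

/-- The semidirect product of `g` and the free module on `ℕ × g` with its trivial connection. It is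
free as a module if `g` is projective. -/
abbrev LRFreeExtension (A g : Type*) [CommRing A] [LieRing g] [Module A g] [LieRingModule g A]
    [LieRinehartRing A g] : Type _ :=
  LRSemidirect (g := g) (LRConnection.isFlat_ofBasis (Finsupp.basisSingleOne (R := A) (ι := ℕ × g)))

theorem LRFreeExtension.nonempty_basis (A g : Type*) [CommRing A] [LieRing g] [Module A g]
    [LieRingModule g A] [LieRinehartRing A g] [Module.Projective A g] :
    Nonempty (Module.Basis (ℕ × g) A (LRFreeExtension A g)) := by
  obtain ⟨s, hs⟩ := Module.Projective.out (R := A) (P := g)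
  exact ⟨.ofRepr <| LRSemidirect.linearEquivProd _ ≪≫ₗ
    (LinearEquiv.refl A g).prodCongr (Finsupp.curryLinearEquiv A) ≪≫ₗ eilenbergSwindle hs ≪≫ₗ
    (Finsupp.curryLinearEquiv A).symm⟩

section SemidirectBasis

variable {k A g M J : Type*} [CommRing k] [CommRing A] [Algebra k A] [LieRing g]
  [LieAlgebra k g] [Module A g] [LieRingModule g A] [LieRinehartRing A g]
  [LieRinehartAlgebra k A g] [AddCommGroup M] [Module A M] {D : LRConnection A g M}
  {hD : D.IsFlat} (b : Module.Basis J A (LRSemidirect hD))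

/-- The projection `S_A(g ⊕ M) → S_A(g)`, in the coordinates of a basis of `g ⊕ M`. -/
def evalFst : MvPolynomial J A →ₐ[A] SymmetricAlgebra A g :=
  MvPolynomial.aeval fun j => SymmetricAlgebra.ι A g (b j).fst

theorem evalFst_constr_X (x : LRSemidirect hD) :
    evalFst b (b.constr A MvPolynomial.X x) = SymmetricAlgebra.ι A g x.fst := by
  suffices (evalFst b).toLinearMap ∘ₗ b.constr A MvPolynomial.X =
      SymmetricAlgebra.ι A g ∘ₗ LinearMap.fst A g M ∘ₗ (LRSemidirect.linearEquivProd hD).toLinearMap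
    from LinearMap.congr_fun this x
  refine b.ext fun j => ?_
  rw [LinearMap.comp_apply, Module.Basis.constr_basis, AlgHom.toLinearMap_apply, evalFst,
    MvPolynomial.aeval_X]
  rfl

theorem evalFst_mem_spanBelow {n : ℕ} {f : MvPolynomial J A} (hf : f ∈ totalDegreeLT A J n) :
    evalFst b f ∈ spanBelow A List.length (wordProd (SymmetricAlgebra.ι A g)) n := by
  suffices spanBelow A List.length (wordProd MvPolynomial.X) n ≤ (spanBelow A List.length
      (wordProd (SymmetricAlgebra.ι A g)) n).comap (evalFst b).toLinearMap from
    this (totalDegreeLT_le_spanBelow_wordProd A J n hf)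
  refine spanBelow_le.2 fun l hl => ?_
  have h : evalFst b (wordProd MvPolynomial.X l) =
      wordProd (SymmetricAlgebra.ι A g) (l.map fun j => (b j).fst) := by
    rw [map_wordProd, wordProd, wordProd, List.map_map]
    simp only [evalFst, MvPolynomial.aeval_X]
    rfl
  rw [Submodule.mem_comap, AlgHom.toLinearMap_apply, h]
  exact apply_mem_spanBelow (by rwa [List.length_map])

variable [LinearOrder J]

variable (k) in
/-- The action of `U_A(g)` on the symmetric algebra of `g ⊕ M`, in the coordinates of a basis of
`g ⊕ M`. -/
def pbwAction : LRUniversalEnveloping k A g →ₐ[k] Module.End k (MvPolynomial J A) :=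
  ((isFlat_pbwConnection b).comap (f := LRSemidirect.inl hD) (fun _ _ => rfl)
    LRSemidirect.inl_lie).action

variable (k) in
/-- The symbol map: the projection to `S_A(g)` of the action on `1`. -/
def symbol : LRUniversalEnveloping k A g →ₗ[A] SymmetricAlgebra A g where
  toFun u := evalFst b (pbwAction k b u 1)
  map_add' u v := by simp only [map_add, LinearMap.add_apply]
  map_smul' a u := by
    rw [pbwAction, LRConnection.IsFlat.action_base_smul, map_smul, RingHom.id_apply]

theorem pbwAction_wordProd_sub_mem (l : List g) :
    pbwAction k b (wordProd (ofLie k A g) l) 1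
      - wordProd (fun X => b.constr A MvPolynomial.X (LRSemidirect.inl hD X)) l ∈
        totalDegreeLT A J l.length := by
  have hlin : ∀ X, b.constr A MvPolynomial.X (LRSemidirect.inl hD X) ∈ totalDegreeLT A J 2 :=
    fun X => constr_X_mem_totalDegreeLT b _
  induction l with
  | nil =>
    rw [wordProd_nil, wordProd_nil, map_one (pbwAction k b), Module.End.one_apply, sub_self]
    exact zero_mem _
  | cons X l ih =>
    have hl : pbwAction k b (wordProd (ofLie k A g) l) 1 ∈ totalDegreeLT A J (l.length + 1) := by
      have h := add_mem (totalDegreeLT_mono l.length.le_succ ih) (wordProd_mem_totalDegreeLT hlin l)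
      rwa [sub_add_cancel] at h
    have h := add_mem (pbwConnection_sub_mem_totalDegreeLT b (LRSemidirect.inl hD X) hl)
      (mul_mem_totalDegreeLT (hlin X) ih)
    rw [mul_sub, sub_add_sub_cancel] at h
    rw [wordProd_cons, wordProd_cons, pbwAction, LRConnection.IsFlat.action_lie_mul]
    exact h

theorem isUnitriangular_symbol :
    IsUnitriangular List.length (wordProd (ofLie k A g))
      (wordProd (SymmetricAlgebra.ι A g)) (symbol k b) := by
  intro l
  have h := evalFst_mem_spanBelow b (pbwAction_wordProd_sub_mem (k := k) b l)
  rw [map_sub, map_wordProd (evalFst b)] at h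
  simp only [evalFst_constr_X, LRSemidirect.fst_inl] at h
  exact h

end SemidirectBasis

theorem exists_isUnitriangular_symbol (k A g : Type*) [CommRing k] [CommRing A] [Algebra k A]
    [LieRing g] [LieAlgebra k g] [Module A g] [LieRingModule g A] [LieRinehartRing A g]
    [LieRinehartAlgebra k A g] [Module.Projective A g] :
    ∃ σ : LRUniversalEnveloping k A g →ₗ[A] SymmetricAlgebra A g,
      IsUnitriangular List.length (wordProd (ofLie k A g))
        (wordProd (SymmetricAlgebra.ι A g)) σ := by
  obtain ⟨b⟩ := LRFreeExtension.nonempty_basis A g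
  let : LinearOrder (ℕ × g) := IsWellOrder.linearOrder WellOrderingRel
  exact ⟨symbol k b, isUnitriangular_symbol b⟩

end Symbol

noncomputable section Symmetrisation

open LRUniversalEnveloping

theorem wordProd_eq_prod_get {X M : Type*} [CommMonoid M] (f : X → M) (l : List X) :
    wordProd f l = ∏ i, f (l.get i) :=
  (Fin.prod_univ_fun_getElem l f).symm

namespace ProjectiveBasis

section Coordinates

variable {I A g : Type*} [CommRing A] [AddCommGroup g] [Module A g] (b : ProjectiveBasis I A g)

theorem finsum_form_smul {M : Type*} [AddCommGroup M] [Module A M] (v : I → M) (X : g) :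
    ∑ᶠ i, b.form i X • v i = ∑ i ∈ b.supp X, b.form i X • v i := by
  refine finsum_eq_sum_of_support_subset _ fun i hi => ?_
  rw [supp, Set.Finite.coe_toFinset]
  exact left_ne_zero_of_smul hi

theorem toPolynomial_ι (X : g) : b.toPolynomial (SymmetricAlgebra.ι A g X) =
    ∑ i ∈ b.supp X, b.form i X • MvPolynomial.X i := by
  rw [toPolynomial, SymmetricAlgebra.lift_ι_apply]
  exact b.finsum_form_smul MvPolynomial.X X

theorem toPolynomial_ι_mem_totalDegreeLT (X : g) :
    b.toPolynomial (SymmetricAlgebra.ι A g X) ∈ totalDegreeLT A I 2 := by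
  rw [toPolynomial_ι]
  exact Submodule.sum_mem _ fun i _ => Submodule.smul_mem _ _ (X_mem_totalDegreeLT i)

end Coordinates

variable {k I A g : Type*} [Field k] [CommRing A] [Algebra k A] [LieRing g] [LieAlgebra k g]
  [Module A g] [LieRingModule g A] (b : ProjectiveBasis I A g)

theorem ofLie_mul_eq_sum (X : g) (u : LRUniversalEnveloping k A g) :
    ofLie k A g X * u = ∑ i ∈ b.supp X, b.form i X • (ofLie k A g (b.gen i) * u) := by
  simp only [← mulConnection_apply, ← LRConnection.smul_apply]
  rw [← AddMonoidHom.finsetSum_apply, ← map_sum, ← b.finsum_form_smul, b.sum_form_smul_gen]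

theorem averageMonomials_wordProd (l : List I) :
    b.averageMonomials k (wordProd MvPolynomial.X l) =
      averagedProduct k fun i => ofLie k A g (b.gen (l.get i)) := by
  rw [wordProd_eq_prod_get, averageMonomials_prod]

variable [CharZero k]

theorem averagedProduct_sub_mem {R U : Type*} [CommRing R] [Algebra k R] [Ring U] [Algebra k U]
    [Module R U] [IsScalarTower k R U] {n : ℕ} {u : Fin n → U} {x : U} {N : Submodule R U}
    (h : ∀ σ : Equiv.Perm (Fin n), (List.ofFn fun i => u (σ i)).prod - x ∈ N) :
    averagedProduct k u - x ∈ N := by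
  have hn : (n.factorial : k) ≠ 0 := Nat.cast_ne_zero.2 n.factorial_ne_zero
  have hx : (n.factorial : k)⁻¹ • ∑ _σ : Equiv.Perm (Fin n), x = x := by
    rw [Finset.sum_const, Finset.card_univ, Fintype.card_perm, Fintype.card_fin,
      ← Nat.cast_smul_eq_nsmul k, inv_smul_smul₀ hn]
  rw [averagedProduct, ← hx, ← smul_sub, ← Finset.sum_sub_distrib]
  exact N.smul_of_tower_mem _ (Submodule.sum_mem _ fun σ _ => h σ)

theorem averageMonomials_wordProd_sub_mem (l : List I) :
    b.averageMonomials k (wordProd MvPolynomial.X l) - wordProd (ofLie k A g) (l.map b.gen) ∈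
      spanBelow A List.length (wordProd (ofLie k A g)) l.length := by
  rw [averageMonomials_wordProd]
  refine averagedProduct_sub_mem fun σ => ?_
  have hperm : (List.ofFn fun i => b.gen (l.get (σ i))).Perm (l.map b.gen) := by
    conv_rhs => rw [← List.ofFn_get l, List.map_ofFn]
    exact Equiv.Perm.ofFn_comp_perm σ (b.gen ∘ l.get)
  have h := wordProd_sub_wordProd_mem_of_perm (k := k) (A := A) hperm
  rwa [wordProd, List.map_ofFn, List.length_ofFn] at h

theorem averageMonomials_mem_spanBelow {n : ℕ} {f : MvPolynomial I A}
    (hf : f ∈ totalDegreeLT A I n) :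
    b.averageMonomials k f ∈ spanBelow A List.length (wordProd (ofLie k A g)) n := by
  suffices spanBelow A List.length (wordProd MvPolynomial.X) n ≤
      (spanBelow A List.length (wordProd (ofLie k A g)) n).comap (b.averageMonomials k) from
    this (totalDegreeLT_le_spanBelow_wordProd A I n hf)
  refine spanBelow_le.2 fun l hl => ?_
  rw [Submodule.mem_comap, ← sub_add_cancel (b.averageMonomials k (wordProd MvPolynomial.X l))]
  exact add_mem (spanBelow_mono hl.le (b.averageMonomials_wordProd_sub_mem l))
    (apply_mem_spanBelow (by rwa [List.length_map]))

theorem averageMonomials_X_mul_sub_mem (i : I) {n : ℕ} {f : MvPolynomial I A}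
    (hf : f ∈ totalDegreeLT A I n) :
    b.averageMonomials k (MvPolynomial.X i * f)
      - ofLie k A g (b.gen i) * b.averageMonomials k f ∈
        spanBelow A List.length (wordProd (ofLie k A g)) n := by
  induction hf using Submodule.span_induction with
  | mem f hf =>
    obtain ⟨m, hm, rfl⟩ := hf
    obtain ⟨l, hl, hlm⟩ := exists_wordProd_X_eq_monomial A m
    have hcons := b.averageMonomials_wordProd_sub_mem (k := k) (i :: l)
    have htail := ofLie_mul_mem_spanBelow_wordProd (b.gen i)
      (b.averageMonomials_wordProd_sub_mem (k := k) l)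
    rw [wordProd_cons, List.map_cons, wordProd_cons] at hcons
    rw [mul_sub] at htail
    have h := sub_mem hcons htail
    rw [sub_sub_sub_cancel_right, hlm] at h
    exact spanBelow_mono (by rw [List.length_cons, hl]; exact hm) h
  | zero => simp only [mul_zero, map_zero, sub_zero, zero_mem]
  | add f f' _ _ h h' => simpa only [mul_add, map_add, add_sub_add_comm] using add_mem h h'
  | smul a f hf h =>
    rw [mul_smul_comm, map_smul, map_smul, ← mulConnection_apply, LRConnection.leibniz,
      ← sub_sub, ← smul_sub]
    exact sub_mem (Submodule.smul_mem _ _ h)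
      (Submodule.smul_mem _ _ (b.averageMonomials_mem_spanBelow hf))

theorem averageMonomials_toPolynomial_ι_mul_sub_mem (X : g) {n : ℕ} {f : MvPolynomial I A}
    (hf : f ∈ totalDegreeLT A I n) :
    b.averageMonomials k (b.toPolynomial (SymmetricAlgebra.ι A g X) * f)
      - ofLie k A g X * b.averageMonomials k f ∈
        spanBelow A List.length (wordProd (ofLie k A g)) n := by
  rw [toPolynomial_ι, b.ofLie_mul_eq_sum, Finset.sum_mul, map_sum, ← Finset.sum_sub_distrib]
  refine Submodule.sum_mem _ fun i _ => ?_
  rw [smul_mul_assoc, map_smul, ← smul_sub]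
  exact Submodule.smul_mem _ _ (b.averageMonomials_X_mul_sub_mem i hf)

theorem isUnitriangular_symmetrisation :
    IsUnitriangular List.length (wordProd (SymmetricAlgebra.ι A g)) (wordProd (ofLie k A g))
      (b.symmetrisation k) := by
  intro l
  have hdeg := wordProd_mem_totalDegreeLT b.toPolynomial_ι_mem_totalDegreeLT
  rw [symmetrisation, LinearMap.comp_apply, AlgHom.toLinearMap_apply, map_wordProd]
  induction l with
  | nil => exact b.averageMonomials_wordProd_sub_mem []
  | cons X l ih =>
    have h := add_mem (b.averageMonomials_toPolynomial_ι_mul_sub_mem (k := k) X (hdeg l))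
      (ofLie_mul_mem_spanBelow_wordProd X ih)
    rwa [mul_sub, sub_add_sub_cancel] at h

theorem symmetrisation_bijective [LieRinehartRing A g] [LieRinehartAlgebra k A g]
    [Module.Projective A g] : Function.Bijective (b.symmetrisation k) := by
  obtain ⟨σ, hσ⟩ := exists_isUnitriangular_symbol k A g
  exact b.isUnitriangular_symmetrisation.bijective hσ (span_range_wordProd_ι A g)
    span_range_wordProd_ofLie

end ProjectiveBasis

end Symmetrisation

section Polarisation

open Finset

theorem sum_neg_one_pow_card_smul_sum_pow {ι R : Type*} [Fintype ι] [DecidableEq ι] [CommRing R]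
    (x : ι → R) :
    ∑ s : Finset ι, (-1 : ℤ) ^ #s • (∑ i ∈ sᶜ, x i) ^ Fintype.card ι =
      (Fintype.card ι).factorial • ∏ i, x i := by
  have hexpand (s : Finset ι) : (∑ i ∈ sᶜ, x i) ^ Fintype.card ι =
      ∑ p ∈ Fintype.piFinset fun _ : ι => sᶜ, ∏ i, x (p i) := by
    rw [← prod_univ_sum, prod_const, card_univ]
  have hswap (s : Finset ι) (p : ι → ι) :
      s ∈ univ ∧ p ∈ Fintype.piFinset (fun _ => sᶜ) ↔ s ∈ (univ.image p)ᶜ.powerset ∧ p ∈ univ := by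
    simp only [mem_univ, true_and, and_true, Fintype.mem_piFinset, mem_compl, mem_powerset,
      subset_compl_comm (s := s), image_subset_iff, true_imp_iff]
  have hsign (p : ι → ι) : ∑ s ∈ (univ.image p)ᶜ.powerset, (-1 : ℤ) ^ #s =
      if p.Bijective then 1 else 0 := by
    simp only [sum_powerset_neg_one_pow_card, compl_eq_empty_iff, eq_univ_iff_forall,
      mem_image, mem_univ, true_and, ← Finite.surjective_iff_bijective, Function.Surjective]
  simp only [hexpand, smul_sum]
  rw [sum_comm' hswap]
  simp only [← sum_smul, hsign, ite_smul, one_smul, zero_smul]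
  rw [← sum_filter, ← Fintype.card_perm, ← card_univ, ← sum_const]
  exact sum_bij' (fun p hp => Equiv.ofBijective p (mem_filter.1 hp).2) (fun σ _ => σ)
    (fun _ _ => mem_univ _) (fun σ _ => mem_filter.2 ⟨mem_univ _, σ.bijective⟩)
    (fun _ _ => rfl) (fun _ _ => Equiv.ext fun _ => rfl)
    fun p hp => (mem_filter.1 hp).2.prod_comp x

theorem prod_mem_of_sum_pow_mem {k R ι : Type*} [Field k] [CharZero k] [CommRing R] [Algebra k R]
    [Fintype ι] {Q : Submodule k R} {x : ι → R}
    (h : ∀ s : Finset ι, (∑ i ∈ s, x i) ^ Fintype.card ι ∈ Q) : ∏ i, x i ∈ Q := by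
  classical
  have hmem := Q.sum_mem fun s (_ : s ∈ univ) => zsmul_mem (h sᶜ) ((-1) ^ #s)
  rw [sum_neg_one_pow_card_smul_sum_pow, ← Nat.cast_smul_eq_nsmul k] at hmem
  exact (Q.smul_mem_iff (Nat.cast_ne_zero.2 (Nat.factorial_ne_zero _))).1 hmem

theorem mvPolynomial_linearMap_ext_of_sum_X_pow (k : Type*) {I A M : Type*} [Field k] [CharZero k]
    [CommRing A] [Algebra k A] [AddCommGroup M] [Module A M] {F G : MvPolynomial I A →ₗ[A] M}
    (h : ∀ (n m : ℕ) (j : Fin m → I) (s : Finset (Fin m)),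
      F ((∑ i ∈ s, MvPolynomial.X (j i)) ^ n) = G ((∑ i ∈ s, MvPolynomial.X (j i)) ^ n)) :
    F = G := by
  refine (MvPolynomial.basisMonomials I A).ext fun m => ?_
  obtain ⟨l, -, hl⟩ := exists_wordProd_X_eq_monomial A m
  change F (MvPolynomial.monomial m 1) = G (MvPolynomial.monomial m 1)
  rw [← hl, wordProd_eq_prod_get]
  exact prod_mem_of_sum_pow_mem (Q := (LinearMap.eqLocus F G).restrictScalars k) fun s => h _ _ _ s

end Polarisation

noncomputable section Coalgebra

open LRUniversalEnveloping

section Powers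

variable {k A g : Type*} [CommRing k] [CommRing A] [Algebra k A] [LieRing g] [LieAlgebra k g]
  [Module A g] [LieRingModule g A]

theorem comul_ofLie_pow (X : g) (n : ℕ) :
    comul k A g (ofLie k A g X ^ n) = ∑ ij ∈ Finset.HasAntidiagonal.antidiagonal n,
      n.choose ij.1 • ((ofLie k A g X ^ ij.1) ⊗ₜ[A] (ofLie k A g X ^ ij.2)) := by
  induction n with
  | zero => simp [comul_one]
  | succ n ih =>
    rw [pow_succ', comul_lie_mul, ih, map_sum, Finset.sum_antidiagonal_choose_succ_nsmul
      (fun i j => (ofLie k A g X ^ i) ⊗ₜ[A] (ofLie k A g X ^ j)), ← Finset.sum_add_distrib]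
    refine Finset.sum_congr rfl fun ij hij => ?_
    rw [map_nsmul, lieTensor_tmul, ← pow_succ', ← pow_succ', nsmul_add, add_comm,
      ← Nat.choose_symm_of_eq_add (Finset.HasAntidiagonal.mem_antidiagonal.1 hij).symm]

theorem counit_ofLie_pow_succ [LieRinehartRing A g] [LieRinehartAlgebra k A g] (X : g) (n : ℕ) :
    counit k A g (ofLie k A g X ^ (n + 1)) = 0 := by
  induction n with
  | zero => rw [pow_succ', pow_zero, counit_lie_mul, counit_one, anchor_one]
  | succ n ih => rw [pow_succ', counit_lie_mul, ih, lie_zero]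

end Powers

section PolynomialComul

variable {I A : Type*} [CommRing A]

variable (I A) in
/-- The comultiplication of polynomials in which the variables are primitive. -/
def polynomialComul : MvPolynomial I A →ₐ[A] MvPolynomial I A ⊗[A] MvPolynomial I A :=
  MvPolynomial.aeval fun i => MvPolynomial.X i ⊗ₜ 1 + 1 ⊗ₜ MvPolynomial.X i

theorem polynomialComul_sum_X_pow {J : Type*} (j : J → I) (s : Finset J) (n : ℕ) :
    polynomialComul I A ((∑ i ∈ s, MvPolynomial.X (j i)) ^ n) =
      ∑ ij ∈ Finset.HasAntidiagonal.antidiagonal n,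
        n.choose ij.1 • (((∑ i ∈ s, MvPolynomial.X (j i)) ^ ij.1) ⊗ₜ[A]
          ((∑ i ∈ s, MvPolynomial.X (j i)) ^ ij.2)) := by
  have h : polynomialComul I A (∑ i ∈ s, MvPolynomial.X (j i)) =
      (∑ i ∈ s, MvPolynomial.X (j i)) ⊗ₜ 1 + 1 ⊗ₜ (∑ i ∈ s, MvPolynomial.X (j i)) := by
    simp [polynomialComul, Finset.sum_add_distrib, TensorProduct.sum_tmul, TensorProduct.tmul_sum]
  rw [map_pow, h, (Commute.all _ _).add_pow']
  simp only [Algebra.TensorProduct.tmul_pow, one_pow, Algebra.TensorProduct.tmul_mul_tmul, mul_one,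
    one_mul]

end PolynomialComul

namespace ProjectiveBasis

section ToPolynomial

variable {I A g : Type*} [CommRing A] [AddCommGroup g] [Module A g] (b : ProjectiveBasis I A g)

theorem polynomialComul_toPolynomial (x : SymmetricAlgebra A g) :
    polynomialComul I A (b.toPolynomial x) =
      TensorProduct.map b.toPolynomial.toLinearMap b.toPolynomial.toLinearMap
        (Coalgebra.comul x) := by
  have h : (polynomialComul I A).comp b.toPolynomial =
      (Algebra.TensorProduct.map b.toPolynomial b.toPolynomial).comp
        (Bialgebra.comulAlgHom A (SymmetricAlgebra A g)) := by
    refine SymmetricAlgebra.algHom_ext (LinearMap.ext fun X => ?_)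
    simp [toPolynomial_ι, polynomialComul, TensorProduct.sum_tmul, TensorProduct.tmul_sum,
      Finset.sum_add_distrib, TensorProduct.smul_tmul']
  exact DFunLike.congr_fun h x

theorem aeval_zero_toPolynomial (x : SymmetricAlgebra A g) :
    MvPolynomial.aeval (fun _ => (0 : A)) (b.toPolynomial x) = Coalgebra.counit x := by
  have h : (MvPolynomial.aeval fun _ => (0 : A)).comp b.toPolynomial =
      Bialgebra.counitAlgHom A (SymmetricAlgebra A g) := by
    refine SymmetricAlgebra.algHom_ext (LinearMap.ext fun X => ?_)
    simp [toPolynomial_ι, SymmetricAlgebra.algebraMapInv_ι]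
  exact DFunLike.congr_fun h x

end ToPolynomial

theorem sum_averagedProduct {k J U : Type*} [Field k] [CharZero k] [Ring U] [Algebra k U]
    (s : Finset J) (u : J → U) (n : ℕ) :
    ∑ p ∈ Fintype.piFinset fun _ : Fin n => s, averagedProduct k (fun i => u (p i)) =
      (∑ i ∈ s, u i) ^ n := by
  have hn : (n.factorial : k) ≠ 0 := Nat.cast_ne_zero.2 n.factorial_ne_zero
  have hexpand : (∑ i ∈ s, u i) ^ n =
      ∑ p ∈ Fintype.piFinset fun _ : Fin n => s, (List.ofFn fun i => u (p i)).prod := by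
    have h := (MultilinearMap.mkPiAlgebraFin ℤ n U).map_sum_finset (fun _ i => u i) fun _ => s
    simpa only [MultilinearMap.mkPiAlgebraFin_apply, List.ofFn_const, List.prod_replicate] using h
  have hperm (σ : Equiv.Perm (Fin n)) :
      ∑ p ∈ Fintype.piFinset fun _ : Fin n => s, (List.ofFn fun i => u (p (σ i))).prod =
        (∑ i ∈ s, u i) ^ n := by
    rw [hexpand]
    refine Finset.sum_equiv (σ.symm.arrowCongr (.refl J)) (fun p => ?_) fun p _ => rfl
    simp only [Fintype.mem_piFinset]
    exact (σ.forall_congr_right (q := fun i => p i ∈ s)).symm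
  simp only [averagedProduct]
  rw [← Finset.smul_sum, Finset.sum_comm, inv_smul_eq_iff₀ hn]
  simp only [hperm]
  rw [Finset.sum_const, Finset.card_univ, Fintype.card_perm, Fintype.card_fin,
    Nat.cast_smul_eq_nsmul k]

variable {I A g k : Type*} [CommRing A] [LieRing g] [Module A g] (b : ProjectiveBasis I A g)
  [Field k] [CharZero k] [Algebra k A] [LieAlgebra k g] [LieRingModule g A]

theorem averageMonomials_sum_X_pow {J : Type*} (j : J → I) (s : Finset J) (n : ℕ) :
    b.averageMonomials k ((∑ i ∈ s, MvPolynomial.X (j i)) ^ n) =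
      ofLie k A g (∑ i ∈ s, b.gen (j i)) ^ n := by
  rw [Finset.sum_pow', map_sum, map_sum, ← sum_averagedProduct (k := k)]
  exact Finset.sum_congr rfl fun p _ => b.averageMonomials_prod k fun i => j (p i)

theorem comul_comp_averageMonomials :
    comul k A g ∘ₗ b.averageMonomials k =
      TensorProduct.map (b.averageMonomials k) (b.averageMonomials k) ∘ₗ
        (polynomialComul I A).toLinearMap := by
  refine mvPolynomial_linearMap_ext_of_sum_X_pow k fun n m j s => ?_
  rw [LinearMap.comp_apply, LinearMap.comp_apply, AlgHom.toLinearMap_apply,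
    averageMonomials_sum_X_pow, comul_ofLie_pow, polynomialComul_sum_X_pow,
    map_sum (TensorProduct.map _ _)]
  refine Finset.sum_congr rfl fun ij _ => ?_
  rw [map_nsmul, TensorProduct.map_tmul, averageMonomials_sum_X_pow, averageMonomials_sum_X_pow]

theorem comul_symmetrisation (x : SymmetricAlgebra A g) :
    comul k A g (b.symmetrisation k x) =
      TensorProduct.map (b.symmetrisation k) (b.symmetrisation k) (Coalgebra.comul x) := by
  rw [symmetrisation, TensorProduct.map_comp, LinearMap.comp_apply, LinearMap.comp_apply,
    AlgHom.toLinearMap_apply, ← polynomialComul_toPolynomial]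
  exact LinearMap.congr_fun b.comul_comp_averageMonomials _

variable [LieRinehartRing A g] [LieRinehartAlgebra k A g]

theorem counit_comp_averageMonomials :
    counit k A g ∘ₗ b.averageMonomials k =
      (MvPolynomial.aeval fun _ : I => (0 : A)).toLinearMap := by
  refine mvPolynomial_linearMap_ext_of_sum_X_pow k fun n m j s => ?_
  rw [LinearMap.comp_apply, averageMonomials_sum_X_pow, AlgHom.toLinearMap_apply,
    map_pow (MvPolynomial.aeval _), map_sum (MvPolynomial.aeval _)]
  simp only [MvPolynomial.aeval_X, Finset.sum_const_zero]
  cases n with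
  | zero => rw [pow_zero, pow_zero, counit_one]
  | succ n => rw [counit_ofLie_pow_succ, zero_pow n.succ_ne_zero]

theorem counit_symmetrisation (x : SymmetricAlgebra A g) :
    counit k A g (b.symmetrisation k x) = Coalgebra.counit x := by
  rw [← b.aeval_zero_toPolynomial]
  exact LinearMap.congr_fun b.counit_comp_averageMonomials _

variable (k) in
/-- The symmetrisation map as a morphism of coalgebras. -/
def symmetrisationCoalgHom : SymmetricAlgebra A g →ₗc[A] LRUniversalEnveloping k A g where
  toLinearMap := b.symmetrisation k
  counit_comp := LinearMap.ext b.counit_symmetrisation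
  map_comp_comul := LinearMap.ext fun x => (b.comul_symmetrisation x).symm

end ProjectiveBasis

end Coalgebra

theorem theorem1p8 {k A g I : Type*} [Field k] [CharZero k] [CommRing A] [Algebra k A]
    [LieRing g] [LieAlgebra k g] [Module A g] [LieRingModule g A] [LieRinehartRing A g]
    [LieRinehartAlgebra k A g] [Module.Projective A g] (b : ProjectiveBasis I A g) :
    ∃ S : SymmetricAlgebra A g ≃ₗc[A] LRUniversalEnveloping k A g,
      ∀ x : SymmetricAlgebra A g, S x = b.symmetrisation k x :=
  ⟨CoalgEquiv.ofBijective (f := b.symmetrisationCoalgHom k) b.symmetrisation_bijective,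
    fun _ => rfl⟩
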